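/- A (connected) map $\mathcal M$, possibly non-orientable or with boundary, is given by a non-empty set $\Phi$ of flags with permutations $r_0,r_1,r_2$ of $\Phi$ which satisfy $r_0^2=r_1^2=r_2^2=(r_0r_2)^2=1$ and generate a transitive group. Its edges are the orbits of $\langle r_0,r_2\rangle$, its automorphism group $\mathrm{Aut}\,\mathcal M$ is the centraliser of $\langle r_0,r_1,r_2\rangle$ in $\mathrm{Sym}(\Phi)$, and $\mathcal M$ is edge-transitive if $\mathrm{Aut}\,\mathcal M$ permutes the edges transitively. The quotient map $\mathcal M/\mathrm{Aut}\,\mathcal M$ has as flags the orbits of $\mathrm{Aut}\,\mathcal M$ on $\Phi$, with the induced permutations. The 14 Graver–Watkins classes $T$ of edge-transitive maps are $1$, $3$ and $2^\sigma$, $2^\sigma\mathrm{ex}$, $4^\sigma$, $5^\sigma$ for $\sigma\in\{\emptyset,*,P\}$. An edge-transitive map $\mathcal M$ has class $T$ if $\mathcal M/\mathrm{Aut}\,\mathcal M$ is isomorphic to the following one-edge map $\mathcal N(T)$, where $t_\sigma$ denotes $r_2$, $r_0$, $r_0r_2$ for $\sigma=\emptyset,*,P$ respectively: - $T=1$: one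 flag. - $T=2^\sigma$ and $T=2^\sigma\mathrm{ex}$: two flags, $t_\sigma$ is trivial and the other two of $r_0,r_2,r_0r_2$ transpose the flags; $r_1$ is trivial for $2^\sigma$ and transposes the flags for $2^\sigma\mathrm{ex}$. - $T=3$, $4^\sigma$, $5^\sigma$: four flags, permuted regularly by $\langle r_0,r_2\rangle\cong V_4$; $r_1$ is trivial for $3$, is the transposition of the two flags in one orbit of $t_\sigma$ for $4^\sigma$, and equals $t_\sigma$ for $5^\sigma$. Let $\mathcal G(T)$ be the class of groups isomorphic to $\mathrm{Aut}\,\mathcal M$ for some map $\mathcal M$ of class $T$. **Theorem.** Let $n\ge 5$ and let $T$ be one of the 14 classes. Then $A_n\in\mathcal G(T)$ if and only if one of the following holds: - $T=1$, and $n=5$ or $n\ge 9$; - $T=2^\sigma$, $3$ or $4^\sigma$ for some $\sigma$; - $T=2^\sigma\mathrm{ex}$ for some $\sigma$, and $n\ge 8$; - $T=5^\sigma$ for some $\sigma$, and $n\ge 7$. -/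

import Mathlib

namespace EdgeTransitive

/-- A connected map, possibly non-orientable and possibly with boundary, given by its
(non-empty) set of flags and by the three permutations of the flags which change the vertex
(`r₀`), the edge (`r₁`), the face (`r₂`) of a flag, a flag without a partner being fixed.
Equivalently, a transitive permutation representation of
`Γ = ⟨R₀, R₁, R₂ | R₀² = R₁² = R₂² = (R₀R₂)² = 1⟩`.  The group `Γ` is countable, so that
flag sets in `Type` give all such representations up to isomorphism. -/
structure FlagMap where
  Flag : Type
  nonempty : Nonempty Flag
  r₀ : Equiv.Perm Flag
  r₁ : Equiv.Perm Flag
  r₂ : Equiv.Perm Flag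
  r₀_sq : r₀ ^ 2 = 1
  r₁_sq : r₁ ^ 2 = 1
  r₂_sq : r₂ ^ 2 = 1
  r₀r₂_sq : (r₀ * r₂) ^ 2 = 1
  connected : MulAction.IsPretransitive (Subgroup.closure {r₀, r₁, r₂}) Flag

namespace FlagMap

/-- The monodromy group. -/
def mon (M : FlagMap) : Subgroup (Equiv.Perm M.Flag) :=
  Subgroup.closure {M.r₀, M.r₁, M.r₂}

/-- The automorphism group: the centraliser of the monodromy group in the symmetric group on
the flags. -/
def aut (M : FlagMap) : Subgroup (Equiv.Perm M.Flag) :=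
  Subgroup.centralizer (M.mon : Set (Equiv.Perm M.Flag))

/-- The edge of a flag, as a set of flags: its orbit under `⟨r₀, r₂⟩`. -/
def edge (M : FlagMap) (φ : M.Flag) : Set M.Flag :=
  MulAction.orbit (Subgroup.closure {M.r₀, M.r₂}) φ

/-- The automorphism group permutes the edges transitively. -/
def IsEdgeTransitive (M : FlagMap) : Prop :=
  ∀ φ ψ : M.Flag, ∃ a ∈ M.aut, a '' M.edge φ = M.edge ψ

/-- Isomorphism of maps. -/
def Isomorphic (M N : FlagMap) : Prop :=
  ∃ e : M.Flag ≃ N.Flag, (∀ φ, e (M.r₀ φ) = N.r₀ (e φ)) ∧ (∀ φ, e (M.r₁ φ) = N.r₁ (e φ)) ∧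
    (∀ φ, e (M.r₂ φ) = N.r₂ (e φ))

/-- The flags of the quotient map: the orbits of the automorphism group on flags. -/
abbrev QuotientFlag (M : FlagMap) : Type := MulAction.orbitRel.Quotient M.aut M.Flag

theorem mon_map_orbit (M : FlagMap) (g : Equiv.Perm M.Flag) (hg : g ∈ M.mon) (φ ψ : M.Flag)
    (h : MulAction.orbitRel M.aut M.Flag φ ψ) :
    MulAction.orbitRel M.aut M.Flag (g φ) (g ψ) := by
  obtain ⟨a, rfl⟩ := h
  refine ⟨a, ?_⟩
  exact (DFunLike.congr_fun (Subgroup.mem_centralizer_iff.mp a.2 g hg) ψ).symm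

/-- The action of the monodromy group on the orbits of the automorphism group. -/
def quotientPerm (M : FlagMap) : M.mon →* Equiv.Perm M.QuotientFlag where
  toFun g :=
    { toFun := Quotient.map g.1 (M.mon_map_orbit g.1 g.2)
      invFun := Quotient.map (g⁻¹).1 (M.mon_map_orbit (g⁻¹).1 (g⁻¹).2)
      left_inv := by rintro ⟨φ⟩; exact congrArg (Quotient.mk _) (g.1.symm_apply_apply φ)
      right_inv := by rintro ⟨φ⟩; exact congrArg (Quotient.mk _) (g.1.apply_symm_apply φ) }
  map_one' := by ext ⟨φ⟩; rfl
  map_mul' g h := by ext ⟨φ⟩; rfl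

theorem r₀_mem (M : FlagMap) : M.r₀ ∈ M.mon := Subgroup.subset_closure (by simp)

theorem r₁_mem (M : FlagMap) : M.r₁ ∈ M.mon := Subgroup.subset_closure (by simp)

theorem r₂_mem (M : FlagMap) : M.r₂ ∈ M.mon := Subgroup.subset_closure (by simp)

/-- The quotient map `M / Aut M`. -/
def quotient (M : FlagMap) : FlagMap where
  Flag := M.QuotientFlag
  nonempty := M.nonempty.map (Quotient.mk _)
  r₀ := M.quotientPerm ⟨M.r₀, M.r₀_mem⟩
  r₁ := M.quotientPerm ⟨M.r₁, M.r₁_mem⟩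
  r₂ := M.quotientPerm ⟨M.r₂, M.r₂_mem⟩
  r₀_sq := by
    rw [← map_pow, show (⟨M.r₀, M.r₀_mem⟩ : M.mon) ^ 2 = 1 from Subtype.ext M.r₀_sq, map_one]
  r₁_sq := by
    rw [← map_pow, show (⟨M.r₁, M.r₁_mem⟩ : M.mon) ^ 2 = 1 from Subtype.ext M.r₁_sq, map_one]
  r₂_sq := by
    rw [← map_pow, show (⟨M.r₂, M.r₂_mem⟩ : M.mon) ^ 2 = 1 from Subtype.ext M.r₂_sq, map_one]
  r₀r₂_sq := by
    rw [← map_mul, ← map_pow, show ((⟨M.r₀, M.r₀_mem⟩ : M.mon) * ⟨M.r₂, M.r₂_mem⟩) ^ 2 = 1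
      from Subtype.ext M.r₀r₂_sq, map_one]
  connected := by
    have key : ∀ g (hg : g ∈ M.mon), M.quotientPerm ⟨g, hg⟩ ∈ Subgroup.closure
        {M.quotientPerm ⟨M.r₀, M.r₀_mem⟩, M.quotientPerm ⟨M.r₁, M.r₁_mem⟩,
          M.quotientPerm ⟨M.r₂, M.r₂_mem⟩} := by
      intro g hg
      induction hg using Subgroup.closure_induction with
      | mem x hx =>
        apply Subgroup.subset_closure
        rcases hx with rfl | rfl | rfl <;> simp
      | one => exact (map_one M.quotientPerm).symm ▸ one_mem _
      | mul x y hx hy ihx ihy =>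
        exact (map_mul M.quotientPerm ⟨x, hx⟩ ⟨y, hy⟩).symm ▸ mul_mem ihx ihy
      | inv x hx ih => exact (map_inv M.quotientPerm ⟨x, hx⟩).symm ▸ inv_mem ih
    refine ⟨?_⟩
    rintro ⟨φ⟩ ⟨ψ⟩
    obtain ⟨⟨g, hg⟩, h⟩ := M.connected.exists_smul_eq φ ψ
    exact ⟨⟨_, key g hg⟩, congrArg (Quotient.mk _) h⟩

/-- A map with one edge: `r₀` and `r₂` already act transitively on the flags. -/
def ofOneEdge (F : Type) [Nonempty F] (r₀ r₁ r₂ : Equiv.Perm F) (h₀ : r₀ ^ 2 = 1)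
    (h₁ : r₁ ^ 2 = 1) (h₂ : r₂ ^ 2 = 1) (h₀₂ : (r₀ * r₂) ^ 2 = 1)
    (h : ∀ φ ψ : F, ψ = φ ∨ ψ = r₀ φ ∨ ψ = r₂ φ ∨ ψ = (r₀ * r₂) φ) : FlagMap where
  Flag := F
  nonempty := inferInstance
  r₀ := r₀
  r₁ := r₁
  r₂ := r₂
  r₀_sq := h₀
  r₁_sq := h₁
  r₂_sq := h₂
  r₀r₂_sq := h₀₂
  connected := by
    have m₀ : r₀ ∈ Subgroup.closure {r₀, r₁, r₂} := Subgroup.subset_closure (by simp)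
    have m₂ : r₂ ∈ Subgroup.closure {r₀, r₁, r₂} := Subgroup.subset_closure (by simp)
    refine ⟨fun φ ψ => ?_⟩
    rcases h φ ψ with e | e | e | e
    · exact ⟨1, e.symm⟩
    · exact ⟨⟨_, m₀⟩, e.symm⟩
    · exact ⟨⟨_, m₂⟩, e.symm⟩
    · exact ⟨⟨_, mul_mem m₀ m₂⟩, e.symm⟩

end FlagMap

/-- The superscripts `∅`, `*`, `P`. -/
inductive Superscript
  | empty
  | star
  | petrie
  deriving DecidableEq

/-- The symbols of the fourteen Graver--Watkins classes of edge-transitive maps: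
`1`, `2^σ`, `2^σ ex`, `3`, `4^σ`, `5^σ`. -/
inductive EdgeClass
  | one
  | two (σ : Superscript)
  | twoEx (σ : Superscript)
  | three
  | four (σ : Superscript)
  | five (σ : Superscript)
  deriving DecidableEq

/-- The three involutions `r₂`, `r₀`, `r₀ r₂` of an edge group, indexed by `∅`, `*`, `P`.
Duality transposes `r₀` and `r₂`, Petrie duality transposes `r₀` and `r₀ r₂`. -/
def Superscript.pick {F : Type} (r₀ r₂ : Equiv.Perm F) : Superscript → Equiv.Perm F
  | .empty => r₂
  | .star => r₀
  | .petrie => r₀ * r₂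

/-- On two flags: `r₀` for the map with one edge in which the involution indexed by `σ` acts
trivially and the other two act as the transposition. -/
def twoFlag₀ : Superscript → Equiv.Perm Bool
  | .empty => Equiv.boolNot
  | .star => 1
  | .petrie => Equiv.boolNot

/-- On two flags: `r₂` for the map with one edge in which the involution indexed by `σ` acts
trivially and the other two act as the transposition. -/
def twoFlag₂ : Superscript → Equiv.Perm Bool
  | .empty => 1
  | .star => Equiv.boolNot
  | .petrie => Equiv.boolNot

/-- On four flags, on which the edge group `⟨r₀, r₂⟩` acts regularly: `r₀`. -/
def fourFlag₀ : Equiv.Perm (Bool × Bool) := Equiv.prodCongr Equiv.boolNot (Equiv.refl Bool)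

/-- On four flags, on which the edge group `⟨r₀, r₂⟩` acts regularly: `r₂`. -/
def fourFlag₂ : Equiv.Perm (Bool × Bool) := Equiv.prodCongr (Equiv.refl Bool) Equiv.boolNot

/-- The fourteen basic maps `𝒩(T)` with one edge.
* `1`: a single flag.
* `2^σ`, `2^σ ex`: two flags, with `r₂`, `r₀`, `r₀ r₂` trivial for `σ = ∅, *, P` respectively,
  and with `r₁` trivial, respectively transposing the two flags.
* `3`, `4^σ`, `5^σ`: four flags, regularly permuted by `⟨r₀, r₂⟩`; `r₁` is trivial for `3`;
  for `5^σ` it is `r₂`, `r₀`, `r₀ r₂` for `σ = ∅, *, P` respectively, and for `4^σ` it agrees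
  with the latter on two flags, which it transposes, and fixes the other two. -/
def EdgeClass.basicMap : EdgeClass → FlagMap
  | .one => FlagMap.ofOneEdge Unit 1 1 1 (by decide) (by decide) (by decide) (by decide)
      (by decide)
  | .two σ => FlagMap.ofOneEdge Bool (twoFlag₀ σ) 1 (twoFlag₂ σ)
      (by cases σ <;> decide) (by decide) (by cases σ <;> decide) (by cases σ <;> decide)
      (by cases σ <;> decide)
  | .twoEx σ => FlagMap.ofOneEdge Bool (twoFlag₀ σ) Equiv.boolNot (twoFlag₂ σ)
      (by cases σ <;> decide) (by decide) (by cases σ <;> decide) (by cases σ <;> decide)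
      (by cases σ <;> decide)
  | .three => FlagMap.ofOneEdge (Bool × Bool) fourFlag₀ 1 fourFlag₂
      (by decide) (by decide) (by decide) (by decide) (by decide)
  | .four σ => FlagMap.ofOneEdge (Bool × Bool) fourFlag₀
      (Equiv.swap (false, false) (σ.pick fourFlag₀ fourFlag₂ (false, false))) fourFlag₂
      (by decide) (by cases σ <;> decide) (by decide) (by decide) (by decide)
  | .five σ => FlagMap.ofOneEdge (Bool × Bool) fourFlag₀ (σ.pick fourFlag₀ fourFlag₂) fourFlag₂
      (by decide) (by cases σ <;> decide) (by decide) (by decide) (by decide)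

/-- The map `M` is an edge-transitive map of class `T`: its quotient by its automorphism group
is isomorphic to the basic map `𝒩(T)`. -/
def FlagMap.InClass (M : FlagMap) (T : EdgeClass) : Prop :=
  M.IsEdgeTransitive ∧ M.quotient.Isomorphic T.basicMap

/-- Membership of `G` in `𝒢(T)`: the group `G` is isomorphic to the automorphism group of some
map of class `T`. -/
def IsRealised (T : EdgeClass) (G : Type*) [Group G] : Prop :=
  ∃ M : FlagMap, M.InClass T ∧ Nonempty (G ≃* M.aut)

end EdgeTransitive

/-!
The automorphism group acts semiregularly on flags, so the flags of an edge-transitive map of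
class `T` are `Aut M` times the flags of `𝒩(T)`, and the map is the covering of `𝒩(T)` given by
voltages in `Aut M`. Hence `G ∈ 𝒢(T)` says that `G` has generators of a prescribed kind: for `T = 1`
three involutions two of which commute, for `2ex` an involution and a second element and for `5`
two elements, in the last two cases not inverted entrywise by an automorphism of `G`. Duality and
Petrie duality permute the superscripts.

Alternating groups of large degree arise by attaching a path of four points to generating
permutations of `n` points, which gives generating permutations of `n + 4` points: the new group is
primitive and contains a `3`-cycle, so Jordan's theorem applies, and finitely many base cases
remain.

The exclusions in degrees `5` and `6` rest on `A₆ ≅ PSL₂(9)`: if `A, B ∈ SL₂` do not commute, then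
conjugation by `AB - BA` inverts both, unless this matrix is singular, and then `A` and `B` have a
common eigenvector. The remaining ones, commuting involutions in degrees `6` to `8` and pairs in
degree `7`, are finite searches up to conjugacy: such permutations preserve a proper family of
sets, for instance the lines of a Fano plane, or are inverted by a common permutation.
-/

namespace EdgeTransitive

/-! ### Quotients by the automorphism group -/

namespace FlagMap

variable {M N N' : FlagMap}

/-- The three permutations `r₀`, `r₁`, `r₂` of the flags as one family, so that statements about
all three of them can be made at once. -/
def r (M : FlagMap) : Fin 3 → Equiv.Perm M.Flag := ![M.r₀, M.r₁, M.r₂]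

theorem closure_range_r (M : FlagMap) : Subgroup.closure (Set.range M.r) = M.mon :=
  congrArg Subgroup.closure (by
    ext w
    simp only [r, Set.mem_range, Fin.exists_fin_succ, IsEmpty.exists_iff, eq_comm (b := w)]
    simp)

theorem r_mem_mon (M : FlagMap) (i : Fin 3) : M.r i ∈ M.mon :=
  M.closure_range_r ▸ Subgroup.subset_closure ⟨i, rfl⟩

@[simp]
theorem r_r (M : FlagMap) (i : Fin 3) (φ : M.Flag) : M.r i (M.r i φ) = φ := by
  have h : M.r i ^ 2 = 1 := by
    fin_cases i
    exacts [M.r₀_sq, M.r₁_sq, M.r₂_sq]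
  rw [← Equiv.Perm.mul_apply, ← sq, h, Equiv.Perm.one_apply]

theorem r_zero_r_two (M : FlagMap) (φ : M.Flag) : M.r 0 (M.r 2 φ) = M.r 2 (M.r 0 φ) := by
  have h : M.r 0 (M.r 2 (M.r 0 (M.r 2 (M.r 2 (M.r 0 φ))))) = M.r 2 (M.r 0 φ) := by
    have := DFunLike.congr_fun M.r₀r₂_sq (M.r 2 (M.r 0 φ))
    rwa [sq] at this
  rwa [r_r, r_r] at h

theorem mem_aut_iff {a : Equiv.Perm M.Flag} :
    a ∈ M.aut ↔ ∀ i φ, a (M.r i φ) = M.r i (a φ) := by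
  rw [aut, ← closure_range_r, Subgroup.centralizer_closure, Subgroup.mem_centralizer_iff,
    Set.forall_mem_range]
  exact forall_congr' fun i => Equiv.ext_iff.trans (forall_congr' fun φ => eq_comm)

theorem smul_mon (a : M.aut) {w : Equiv.Perm M.Flag} (hw : w ∈ M.mon) (φ : M.Flag) :
    a • w φ = w (a • φ) :=
  (DFunLike.congr_fun (Subgroup.mem_centralizer_iff.mp a.2 w hw) φ).symm

theorem smul_r (a : M.aut) (i : Fin 3) (φ : M.Flag) : a • M.r i φ = M.r i (a • φ) :=
  smul_mon a (M.r_mem_mon i) φ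

theorem flag_induction {P : M.Flag → Prop} {φ₀ : M.Flag} (base : P φ₀)
    (step : ∀ i φ, P φ → P (M.r i φ)) (φ : M.Flag) : P φ := by
  have step_iff : ∀ w ∈ M.mon, ∀ φ, P φ ↔ P (w φ) := by
    intro w hw
    rw [← closure_range_r] at hw
    induction hw using Subgroup.closure_induction with
    | mem w hw =>
      obtain ⟨i, rfl⟩ := hw
      exact fun φ => ⟨step i φ, fun h => M.r_r i φ ▸ step i _ h⟩
    | one => exact fun φ => Iff.rfl
    | mul v w _ _ ihv ihw => exact fun φ => (ihw φ).trans (ihv _)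
    | inv w _ ih => exact fun φ => by simpa using (ih (w⁻¹ φ)).symm
  obtain ⟨⟨w, hw⟩, rfl⟩ := M.connected.exists_smul_eq φ₀ φ
  exact (step_iff w hw φ₀).1 base

theorem aut_ext {a b : M.aut} {φ₀ : M.Flag} (h : a • φ₀ = b • φ₀) : a = b :=
  Subtype.ext <| Equiv.ext <| flag_induction (P := fun φ => a • φ = b • φ) h
    fun i φ h => by rw [smul_r, smul_r, h]

/-- The map of flags `f` identifies `N` with the quotient map `M / Aut M`. -/
structure IsAutQuotient (M N : FlagMap) (f : M.Flag → N.Flag) : Prop where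
  surjective : Function.Surjective f
  map_r : ∀ i φ, f (M.r i φ) = N.r i (f φ)
  eq_iff : ∀ {φ ψ}, f φ = f ψ ↔ ∃ a : M.aut, a • φ = ψ

theorem isomorphic_iff :
    M.Isomorphic N ↔ ∃ e : M.Flag ≃ N.Flag, ∀ i φ, e (M.r i φ) = N.r i (e φ) := by
  simp [Isomorphic, Fin.forall_fin_succ, r]

theorem quotient_r_mk (i : Fin 3) (φ : M.Flag) :
    M.quotient.r i (Quotient.mk _ φ) = Quotient.mk (MulAction.orbitRel M.aut M.Flag) (M.r i φ) := by
  fin_cases i <;> rfl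

theorem isAutQuotient_mk (M : FlagMap) : IsAutQuotient M M.quotient (Quotient.mk _) where
  surjective := Quotient.mk_surjective
  map_r i φ := (quotient_r_mk i φ).symm
  eq_iff := by
    exact ⟨fun h => Quotient.exact h.symm, fun h => (Quotient.sound h).symm⟩

theorem IsAutQuotient.comp_equiv {f : M.Flag → N.Flag} (hf : IsAutQuotient M N f)
    {e : N.Flag ≃ N'.Flag} (he : ∀ i x, e (N.r i x) = N'.r i (e x)) :
    IsAutQuotient M N' (e ∘ f) where
  surjective := e.surjective.comp hf.surjective
  map_r i φ := by simp only [Function.comp_apply, hf.map_r, he]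
  eq_iff := e.injective.eq_iff.trans hf.eq_iff

theorem quotient_isomorphic_iff : M.quotient.Isomorphic N ↔ ∃ f, IsAutQuotient M N f := by
  rw [isomorphic_iff]
  constructor
  · rintro ⟨e, he⟩
    exact ⟨_, M.isAutQuotient_mk.comp_equiv he⟩
  · rintro ⟨f, hf⟩
    have mk_eq_iff {φ ψ} := M.isAutQuotient_mk.eq_iff (φ := φ) (ψ := ψ)
    let g : M.QuotientFlag → N.Flag :=
      Quotient.lift f fun φ ψ h => hf.eq_iff.2 (mk_eq_iff.1 (Quotient.sound h))
    refine ⟨Equiv.ofBijective g ⟨?_, ?_⟩, ?_⟩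
    · rintro ⟨φ⟩ ⟨ψ⟩ h
      exact mk_eq_iff.2 (hf.eq_iff.1 h)
    · exact fun x => (hf.surjective x).imp' (Quotient.mk _) fun _ => id
    · rintro i ⟨φ⟩
      exact (congrArg g (quotient_r_mk i φ)).trans (hf.map_r i φ)

theorem smul_image_edge (a : M.aut) (φ : M.Flag) : (a : Equiv.Perm M.Flag) '' M.edge φ =
    M.edge (a • φ) := by
  have hle : Subgroup.closure {M.r₀, M.r₂} ≤ M.mon :=
    Subgroup.closure_mono (by rintro x (rfl | rfl) <;> simp)
  have h (w : Subgroup.closure {M.r₀, M.r₂}) : a • (w • φ) = w • (a • φ) := smul_mon a (hle w.2) φ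
  simp only [edge, MulAction.orbit, ← Set.range_comp]
  exact congrArg Set.range (funext h)

/-- The map has only one edge: the flags are permuted transitively by `r₀` and `r₂`. -/
def OneEdge (N : FlagMap) : Prop :=
  ∀ x y : N.Flag, y = x ∨ y = N.r₀ x ∨ y = N.r₂ x ∨ y = (N.r₀ * N.r₂) x

theorem IsAutQuotient.isEdgeTransitive {f : M.Flag → N.Flag} (hf : IsAutQuotient M N f)
    (hN : N.OneEdge) : M.IsEdgeTransitive := by
  intro φ ψ
  have m₀ : M.r₀ ∈ Subgroup.closure {M.r₀, M.r₂} := Subgroup.subset_closure (by simp)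
  have m₂ : M.r₂ ∈ Subgroup.closure {M.r₀, M.r₂} := Subgroup.subset_closure (by simp)
  have map_r₀ (φ) : f (M.r₀ φ) = N.r₀ (f φ) := hf.map_r 0 φ
  have map_r₂ (φ) : f (M.r₂ φ) = N.r₂ (f φ) := hf.map_r 2 φ
  obtain ⟨w, hw⟩ : ∃ w : Subgroup.closure {M.r₀, M.r₂}, f (w • φ) = f ψ := by
    rcases hN (f φ) (f ψ) with h | h | h | h
    · exact ⟨1, h.symm⟩
    · exact ⟨⟨_, m₀⟩, (map_r₀ φ).trans h.symm⟩
    · exact ⟨⟨_, m₂⟩, (map_r₂ φ).trans h.symm⟩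
    · exact ⟨⟨_, mul_mem m₀ m₂⟩, ((map_r₀ _).trans (congrArg _ (map_r₂ φ))).trans h.symm⟩
  obtain ⟨a, rfl⟩ := hf.eq_iff.1 hw
  refine ⟨a, a.2, ?_⟩
  rw [← smul_image_edge, edge, edge, MulAction.orbit_smul]

end FlagMap

theorem FlagMap.oneEdge_ofOneEdge {F : Type} [Nonempty F] {r₀ r₁ r₂ : Equiv.Perm F}
    {h₀ : r₀ ^ 2 = 1} {h₁ : r₁ ^ 2 = 1} {h₂ : r₂ ^ 2 = 1} {h₀₂ : (r₀ * r₂) ^ 2 = 1}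
    {h : ∀ φ ψ : F, ψ = φ ∨ ψ = r₀ φ ∨ ψ = r₂ φ ∨ ψ = (r₀ * r₂) φ} :
    (FlagMap.ofOneEdge F r₀ r₁ r₂ h₀ h₁ h₂ h₀₂ h).OneEdge :=
  h

theorem EdgeClass.oneEdge_basicMap (T : EdgeClass) : T.basicMap.OneEdge := by
  rcases T with _ | σ | σ | _ | σ | σ
  case two | twoEx => exact FlagMap.oneEdge_ofOneEdge (h := by cases σ <;> decide)
  all_goals exact FlagMap.oneEdge_ofOneEdge (h := by decide)

theorem FlagMap.inClass_iff {M : FlagMap} {T : EdgeClass} :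
    M.InClass T ↔ ∃ f, FlagMap.IsAutQuotient M T.basicMap f := by
  rw [FlagMap.InClass, FlagMap.quotient_isomorphic_iff, and_iff_right_iff_imp]
  exact fun ⟨_, hf⟩ => hf.isEdgeTransitive T.oneEdge_basicMap

section Twist

open Subgroup

/-- The operations on the pairs of involutions `(r₀, r₂)` which belong to the three superscripts:
the identity, duality and Petrie duality, the last one conjugated so as to fix `r₀`. The
operation takes `(r₀, r₂)` to the pair of `σ.twist₀ r₀ r₂` and `σ.pick r₀ r₂`. -/
def Superscript.twist₀ {F : Type} (r₀ r₂ : Equiv.Perm F) : Superscript → Equiv.Perm F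
  | .empty => r₀
  | .star => r₂
  | .petrie => r₀

theorem Superscript.closure_twist {F : Type} (σ : Superscript) (r₀ r₁ r₂ : Equiv.Perm F) :
    closure {σ.twist₀ r₀ r₂, r₁, σ.pick r₀ r₂} = closure {r₀, r₁, r₂} := by
  cases σ
  case empty => rfl
  case star =>
    change closure {r₂, r₁, r₀} = _
    congr 1
    ext
    simp only [Set.mem_insert_iff, Set.mem_singleton_iff]
    tauto
  case petrie =>
    change closure {r₀, r₁, r₀ * r₂} = _
    have h₀ {s : Equiv.Perm F} : r₀ ∈ closure {r₀, r₁, s} := subset_closure (by simp)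
    have h₁ {s : Equiv.Perm F} : r₁ ∈ closure {r₀, r₁, s} := subset_closure (by simp)
    have h₂ {s : Equiv.Perm F} : s ∈ closure {r₀, r₁, s} := subset_closure (by simp)
    refine le_antisymm ((closure_le _).2 ?_) ((closure_le _).2 ?_)
    · rintro _ (rfl | rfl | rfl)
      exacts [h₀, h₁, mul_mem h₀ h₂]
    · rintro _ (rfl | rfl | rfl)
      exacts [h₀, h₁, (mul_mem_cancel_left h₀).1 h₂]

namespace FlagMap

variable {M N : FlagMap} {σ : Superscript}

/-- The operations on maps which permute the involutions `r₂`, `r₀`, `r₀ r₂` of the edge groups,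
see `Superscript.twist₀`. -/
def twist (σ : Superscript) (M : FlagMap) : FlagMap where
  Flag := M.Flag
  nonempty := M.nonempty
  r₀ := σ.twist₀ M.r₀ M.r₂
  r₁ := M.r₁
  r₂ := σ.pick M.r₀ M.r₂
  r₀_sq := by cases σ <;> simp [Superscript.twist₀, M.r₀_sq, M.r₂_sq]
  r₁_sq := M.r₁_sq
  r₂_sq := by cases σ <;> simp [Superscript.pick, M.r₀_sq, M.r₂_sq, M.r₀r₂_sq]
  r₀r₂_sq := by
    cases σ
    · exact M.r₀r₂_sq
    · change (M.r₂ * M.r₀) ^ 2 = 1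
      rw [show M.r₂ * M.r₀ = M.r₂ * (M.r₀ * M.r₂) * M.r₂⁻¹ by group, conj_pow, M.r₀r₂_sq, mul_one,
        mul_inv_cancel]
    · change (M.r₀ * (M.r₀ * M.r₂)) ^ 2 = 1
      rw [← mul_assoc, ← sq, M.r₀_sq, one_mul, M.r₂_sq]
  connected := σ.closure_twist M.r₀ M.r₁ M.r₂ ▸ M.connected

theorem aut_twist : (M.twist σ).aut = M.aut :=
  congrArg (fun H : Subgroup (Equiv.Perm M.Flag) => centralizer (H : Set (Equiv.Perm M.Flag)))
    (σ.closure_twist M.r₀ M.r₁ M.r₂)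

theorem map_twist {f : M.Flag → N.Flag} (hf : ∀ i φ, f (M.r i φ) = N.r i (f φ)) (i : Fin 3)
    (φ : M.Flag) : f ((M.twist σ).r i φ) = (N.twist σ).r i (f φ) := by
  have h₀ (φ) : f (M.r₀ φ) = N.r₀ (f φ) := hf 0 φ
  have h₂ (φ) : f (M.r₂ φ) = N.r₂ (f φ) := hf 2 φ
  fin_cases i
  · cases σ <;> [exact h₀ φ; exact h₂ φ; exact h₀ φ]
  · exact hf 1 φ
  · cases σ <;> [exact h₂ φ; exact h₀ φ; exact (h₀ _).trans (congrArg N.r₀ (h₂ φ))]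

theorem IsAutQuotient.twist {f : M.Flag → N.Flag} (hf : IsAutQuotient M N f) :
    IsAutQuotient (M.twist σ) (N.twist σ) f where
  surjective := hf.surjective
  map_r := map_twist hf.map_r
  eq_iff {φ ψ} := by
    have h := hf.eq_iff (φ := φ) (ψ := ψ)
    rw [← M.aut_twist (σ := σ)] at h
    exact h

theorem twist_twist_r (i : Fin 3) (φ : M.Flag) : ((M.twist σ).twist σ).r i φ = M.r i φ := by
  fin_cases i
  · cases σ <;> rfl
  · rfl
  · cases σ <;> [rfl; rfl; exact M.r_r 0 (M.r₂ φ)]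

theorem Isomorphic.of_twist (h : (M.twist σ).Isomorphic N) : (N.twist σ).Isomorphic M := by
  obtain ⟨e, he⟩ := isomorphic_iff.1 h
  have hsymm (i x) : e.symm (N.r i x) = (M.twist σ).r i (e.symm x) := by
    rw [Equiv.symm_apply_eq, he, Equiv.apply_symm_apply]
  exact isomorphic_iff.2
    ⟨e.symm, fun i x => (map_twist (σ := σ) hsymm i x).trans (twist_twist_r i _)⟩

end FlagMap

open FlagMap

variable {T T' : EdgeClass} {G : Type*} [Group G]

theorem IsRealised.of_twist {σ : Superscript} (h : (T.basicMap.twist σ).Isomorphic T'.basicMap)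
    (hG : IsRealised T G) : IsRealised T' G := by
  obtain ⟨M, hM, ⟨e⟩⟩ := hG
  obtain ⟨f, hf⟩ := inClass_iff.1 hM
  obtain ⟨i, hi⟩ := isomorphic_iff.1 h
  exact ⟨M.twist σ, inClass_iff.2 ⟨_, hf.twist.comp_equiv hi⟩,
    ⟨e.trans (MulEquiv.subgroupCongr aut_twist.symm)⟩⟩

theorem isRealised_congr_of_twist {σ : Superscript}
    (h : (T.basicMap.twist σ).Isomorphic T'.basicMap) : IsRealised T G ↔ IsRealised T' G :=
  ⟨.of_twist h, .of_twist h.of_twist⟩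

theorem isRealised_two_iff_empty {σ : Superscript} :
    IsRealised (.two σ) G ↔ IsRealised (.two .empty) G :=
  isRealised_congr_of_twist (σ := σ) ⟨Equiv.refl Bool, by
    cases σ <;> refine ⟨?_, ?_, ?_⟩ <;> rintro (_ | _) <;> rfl⟩

theorem isRealised_twoEx_iff_empty {σ : Superscript} :
    IsRealised (.twoEx σ) G ↔ IsRealised (.twoEx .empty) G :=
  isRealised_congr_of_twist (σ := σ) ⟨Equiv.refl Bool, by
    cases σ <;> refine ⟨?_, ?_, ?_⟩ <;> rintro (_ | _) <;> rfl⟩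

/-- An involution on the four flags which conjugates `fourFlag₂` to the involution indexed
by `σ`. -/
def fourFlagIso : Superscript → Equiv.Perm (Bool × Bool)
  | .empty => 1
  | .star => Equiv.prodComm Bool Bool
  | .petrie => Equiv.swap (true, true) (false, true)

theorem isRealised_four_iff_empty {σ : Superscript} :
    IsRealised (.four σ) G ↔ IsRealised (.four .empty) G :=
  isRealised_congr_of_twist (σ := σ) ⟨fourFlagIso σ, by
    cases σ <;> refine ⟨?_, ?_, ?_⟩ <;> rintro ⟨_ | _, _ | _⟩ <;> rfl⟩

theorem isRealised_five_iff_empty {σ : Superscript} :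
    IsRealised (.five σ) G ↔ IsRealised (.five .empty) G :=
  isRealised_congr_of_twist (σ := σ) ⟨fourFlagIso σ, by
    cases σ <;> refine ⟨?_, ?_, ?_⟩ <;> rintro ⟨_ | _, _ | _⟩ <;> rfl⟩

end Twist

/-! ### Coverings by voltage assignments -/

section Coverings

open FlagMap

/-- A voltage assignment on the map `N` with values in the group `G`: the step of the involution
`r i` from the flag `x` carries the voltage `v i x`. The voltage of a walk is the product of the
voltages of its steps in the order in which they are taken, and the two conditions say that it is
trivial for the closed walks given by `r i ^ 2 = 1` and by `r₀ r₂ = r₂ r₀`. -/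
structure Voltage (N : FlagMap) (G : Type) [Group G] where
  v : Fin 3 → N.Flag → G
  mul_v : ∀ i x, v i x * v i (N.r i x) = 1
  comm : ∀ x, v 0 x * v 2 (N.r 0 x) = v 2 x * v 0 (N.r 2 x)

namespace Voltage

variable {N : FlagMap} {G : Type} [Group G] (W : Voltage N G)

/-- The involution `r i` lifted to the flags of the covering map, which are the pairs of a flag
of `N` and an element of `G`. -/
def lift (i : Fin 3) : Equiv.Perm (N.Flag × G) :=
  Function.Involutive.toPerm (fun p => (N.r i p.1, p.2 * W.v i p.1)) fun p => by
    simp [mul_assoc, W.mul_v]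

@[simp]
theorem lift_apply (i : Fin 3) (p : N.Flag × G) :
    W.lift i p = (N.r i p.1, p.2 * W.v i p.1) := rfl

@[simp]
theorem lift_lift (i : Fin 3) (p : N.Flag × G) : W.lift i (W.lift i p) = p :=
  (W.lift i).left_inv p

/-- The group generated by the lifted involutions. -/
def mon : Subgroup (Equiv.Perm (N.Flag × G)) :=
  Subgroup.closure {W.lift 0, W.lift 1, W.lift 2}

theorem lift_mem_mon (i : Fin 3) : W.lift i ∈ W.mon :=
  Subgroup.subset_closure (by fin_cases i <;> simp)

/-- The covering map of `N` with fibre `G` which belongs to the voltages, if it is connected. -/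
def derived (h : MulAction.IsPretransitive W.mon (N.Flag × G)) : FlagMap where
  Flag := N.Flag × G
  nonempty := N.nonempty.map (·, 1)
  r₀ := W.lift 0
  r₁ := W.lift 1
  r₂ := W.lift 2
  r₀_sq := Equiv.ext (W.lift_lift 0)
  r₁_sq := Equiv.ext (W.lift_lift 1)
  r₂_sq := Equiv.ext (W.lift_lift 2)
  r₀r₂_sq := by
    have hcomm (p) : W.lift 0 (W.lift 2 p) = W.lift 2 (W.lift 0 p) := by
      simp only [lift_apply, mul_assoc, W.comm, r_zero_r_two]
    exact Equiv.ext fun p => by simp only [sq, Equiv.Perm.mul_apply, ← hcomm, lift_lift]; rfl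
  connected := h

theorem derived_r (h : MulAction.IsPretransitive W.mon (N.Flag × G)) (i : Fin 3) :
    (W.derived h).r i = W.lift i := by
  fin_cases i <;> rfl

section Loops

variable {W} {ι : Type*} {x₀ : N.Flag} {w : ι → Equiv.Perm (N.Flag × G)} {c : ι → G}

theorem exists_walk_of_closure_eq_top (hw : ∀ i, w i ∈ W.mon)
    (hwc : ∀ i g, w i (x₀, g) = (x₀, g * c i)) (hc : Subgroup.closure (Set.range c) = ⊤) (k : G) :
    ∃ u ∈ W.mon, ∀ g, u (x₀, g) = (x₀, g * k) := by
  induction hc ▸ Subgroup.mem_top k using Subgroup.closure_induction with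
  | mem k hk =>
    obtain ⟨i, rfl⟩ := hk
    exact ⟨w i, hw i, hwc i⟩
  | one => exact ⟨1, one_mem _, by simp⟩
  | mul k l _ _ ihk ihl =>
    obtain ⟨u, hu, huk⟩ := ihk
    obtain ⟨v, hv, hvl⟩ := ihl
    exact ⟨v * u, mul_mem hv hu, fun g => by simp [huk, hvl, mul_assoc]⟩
  | inv k _ ih =>
    obtain ⟨u, hu, huk⟩ := ih
    exact ⟨u⁻¹, inv_mem hu, fun g => by rw [Equiv.Perm.inv_eq_iff_eq, huk]; simp⟩

theorem isPretransitive_of_closure_eq_top (hw : ∀ i, w i ∈ W.mon)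
    (hwc : ∀ i g, w i (x₀, g) = (x₀, g * c i)) (hc : Subgroup.closure (Set.range c) = ⊤) :
    MulAction.IsPretransitive W.mon (N.Flag × G) := by
  have reach (x) : ∀ g, ∃ u : W.mon, u • (x₀, (1 : G)) = (x, g) := by
    refine flag_induction (P := fun x => ∀ g, ∃ u : W.mon, u • (x₀, (1 : G)) = (x, g)) (φ₀ := x₀)
      (fun g => ?_) (fun i x hx g => ?_) x
    · obtain ⟨u, hu, hug⟩ := exists_walk_of_closure_eq_top hw hwc hc g
      exact ⟨⟨u, hu⟩, (hug 1).trans (by rw [one_mul])⟩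
    · obtain ⟨u, hu⟩ := hx (g * (W.v i x)⁻¹)
      refine ⟨⟨W.lift i, W.lift_mem_mon i⟩ * u, ?_⟩
      rw [mul_smul, hu]
      exact (W.lift_apply i _).trans (by rw [inv_mul_cancel_right])
  refine ⟨fun p q => ?_⟩
  obtain ⟨u, hu⟩ := reach p.1 p.2
  obtain ⟨v, hv⟩ := reach q.1 q.2
  exact ⟨v * u⁻¹, by rw [mul_smul, inv_smul_eq_iff.2 hu.symm, hv]⟩

end Loops

/-- The group `G`, translating the fibres from the left, as a group of automorphisms of the
covering map. -/
def deck (h : MulAction.IsPretransitive W.mon (N.Flag × G)) : G →* (W.derived h).aut where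
  toFun k := ⟨(Equiv.prodCongr (Equiv.refl N.Flag) (Equiv.mulLeft k) : Equiv.Perm (N.Flag × G)),
    mem_aut_iff.2 fun i p => by
      simp only [derived_r]
      exact Prod.ext rfl (mul_assoc _ _ _).symm⟩
  map_one' := Subtype.ext <| Equiv.ext fun p => Prod.ext rfl (one_mul _)
  map_mul' k l := Subtype.ext <| Equiv.ext fun p => Prod.ext rfl (mul_assoc k l p.2)

theorem isRealised_of_loops {T : EdgeClass} {W : Voltage T.basicMap G} {ι : Type*}
    {x₀ : T.basicMap.Flag} (w : ι → Equiv.Perm (T.basicMap.Flag × G)) {c : ι → G}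
    (hw : ∀ i, w i ∈ W.mon) (hwc : ∀ i g, w i (x₀, g) = (x₀, g * c i))
    (hc : Subgroup.closure (Set.range c) = ⊤)
    (rigid : ∀ a : Equiv.Perm (T.basicMap.Flag × G), (∀ u ∈ W.mon, ∀ p, a (u p) = u (a p)) →
      ∀ y, a (x₀, 1) = (y, 1) → y = x₀) : IsRealised T G := by
  have h := isPretransitive_of_closure_eq_top hw hwc hc
  have deck_surjective : Function.Surjective (W.deck h) := by
    intro a
    set y := (a • (show (W.derived h).Flag from (x₀, 1))).1 with hy
    set k := (a • (show (W.derived h).Flag from (x₀, 1))).2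
    have hyx : y = x₀ := rigid (W.deck h k⁻¹ * a).1
      (fun u hu p => smul_mon (M := W.derived h) _ hu p) y
      (Prod.ext rfl (inv_mul_cancel k))
    exact ⟨k, aut_ext (φ₀ := show (W.derived h).Flag from (x₀, 1)) <|
      Prod.ext (hyx.symm.trans hy) (mul_one k)⟩
  have quotient_fst : IsAutQuotient (W.derived h) T.basicMap Prod.fst :=
    { surjective := fun x => ⟨(x, 1), rfl⟩
      map_r := fun i p => by rw [derived_r]; rfl
      eq_iff := by
        rintro ⟨x, g⟩ ⟨y, k⟩
        constructor
        · rintro rfl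
          exact ⟨W.deck h (k * g⁻¹), Prod.ext rfl (inv_mul_cancel_right k g)⟩
        · rintro ⟨a, ha⟩
          obtain ⟨l, rfl⟩ := deck_surjective a
          exact show x = y from congrArg Prod.fst (show (x, l * g) = (y, k) from ha) }
  have deck_injective : Function.Injective (W.deck h) := fun k l hkl => by
    have := congrArg (fun a => (a • (show (W.derived h).Flag from (x₀, 1))).2) hkl
    exact mul_right_cancel this
  exact ⟨W.derived h, inClass_iff.2 ⟨_, quotient_fst⟩,
    ⟨MulEquiv.ofBijective (W.deck h) ⟨deck_injective, deck_surjective⟩⟩⟩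

end Voltage

open Subgroup in
theorem bijective_comp_subtype {G H : Type*} [Group G] [Group H] {K : Subgroup G} (π : G →* H)
    (surj : K.map π = ⊤) (inj : ∀ p ∈ K, π p = 1 → p = 1) :
    Function.Bijective (π ∘ K.subtype) := by
  refine ⟨(injective_iff_map_eq_one (π.comp K.subtype)).2 fun p hp =>
    Subtype.ext (inj p p.2 hp), fun g => ?_⟩
  obtain ⟨p, hp, rfl⟩ := surj ▸ mem_top g
  exact ⟨⟨p, hp⟩, rfl⟩

open Subgroup in
theorem exists_mulEquiv_of_mem_closure {G H ι : Type*} [Group G] [Group H] {c : ι → G} {d : ι → H}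
    (hc : closure (Set.range c) = ⊤) (hd : closure (Set.range d) = ⊤)
    (h : ∀ p ∈ closure (Set.range fun i => (c i, d i)), p.1 = 1 ↔ p.2 = 1) :
    ∃ α : G ≃* H, ∀ i, α (c i) = d i := by
  set K := closure (Set.range fun i => (c i, d i)) with hK
  have fst_bijective := bijective_comp_subtype (MonoidHom.fst G H)
    (by rw [hK, MonoidHom.map_closure, ← Set.range_comp, ← hc]; rfl)
    fun p hp h₁ => Prod.ext h₁ ((h p hp).1 h₁)
  have snd_bijective := bijective_comp_subtype (MonoidHom.snd G H)
    (by rw [hK, MonoidHom.map_closure, ← Set.range_comp, ← hd]; rfl)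
    fun p hp h₂ => Prod.ext ((h p hp).2 h₂) h₂
  obtain ⟨α, hα⟩ := exists_mulEquiv_eq_graph fst_bijective snd_bijective
  have mem_graph (i) : (c i, d i) ∈ α.toMonoidHom.graph := hα ▸ subset_closure ⟨i, rfl⟩
  exact ⟨α, fun i => MonoidHom.mem_graph.1 (mem_graph i)⟩

open Subgroup in
theorem exists_mulEquiv_of_commute {X G ι : Type*} [Group G] {a : Equiv.Perm (X × G)}
    {w : ι → Equiv.Perm (X × G)} (ha : ∀ i p, a (w i p) = w i (a p)) {x y : X} {c d : ι → G}
    (hx : ∀ i g, w i (x, g) = (x, g * c i)) (hy : ∀ i g, w i (y, g) = (y, g * d i))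
    (hxy : a (x, 1) = (y, 1)) (hc : closure (Set.range c) = ⊤) (hd : closure (Set.range d) = ⊤) :
    ∃ α : G ≃* G, ∀ i, α (c i) = d i := by
  have exists_walk : ∀ p ∈ closure (Set.range fun i => (c i, d i)), ∃ u : Equiv.Perm (X × G),
      Commute a u ∧ (∀ g, u (x, g) = (x, g * p.1)) ∧ ∀ g, u (y, g) = (y, g * p.2) := by
    intro p hp
    induction hp using closure_induction with
    | mem p hp =>
      obtain ⟨i, rfl⟩ := hp
      exact ⟨w i, Equiv.ext (ha i), hx i, hy i⟩
    | one => exact ⟨1, Commute.one_right a, by simp, by simp⟩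
    | mul p q _ _ ihp ihq =>
      obtain ⟨u, hau, hux, huy⟩ := ihp
      obtain ⟨v, hav, hvx, hvy⟩ := ihq
      exact ⟨v * u, hav.mul_right hau, by simp [hux, hvx, mul_assoc],
        by simp [huy, hvy, mul_assoc]⟩
    | inv p _ ih =>
      obtain ⟨u, hau, hux, huy⟩ := ih
      exact ⟨u⁻¹, hau.inv_right, fun g => by rw [Equiv.Perm.inv_eq_iff_eq, hux]; simp,
        fun g => by rw [Equiv.Perm.inv_eq_iff_eq, huy]; simp⟩
  refine exists_mulEquiv_of_mem_closure hc hd fun p hp => ?_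
  obtain ⟨u, hau, hux, huy⟩ := exists_walk p hp
  have key : a (x, p.1) = (y, p.2) := by
    have := DFunLike.congr_fun hau (x, 1)
    simpa only [Equiv.Perm.mul_apply, hux, hxy, huy, one_mul] using this
  constructor
  · intro h
    rw [h, hxy] at key
    exact (congrArg Prod.snd key).symm
  · intro h
    rw [h, ← hxy] at key
    exact congrArg Prod.snd (a.injective key)

namespace FlagMap.IsAutQuotient

variable {M N : FlagMap} {f : M.Flag → N.Flag} {s : N.Flag → M.Flag} {G : Type} [Group G]
  {v : Fin 3 → N.Flag → G} {e : G ≃* M.aut}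

theorem smul_section_inj (hf : IsAutQuotient M N f) (hs : ∀ x, f (s x) = x) {a b : M.aut}
    {x y : N.Flag} : a • s x = b • s y ↔ x = y ∧ a = b := by
  refine ⟨fun h => ?_, by rintro ⟨rfl, rfl⟩; rfl⟩
  have hxy : x = y := by
    rw [← hs x, ← hs y, hf.eq_iff]
    exact ⟨b⁻¹ * a, by rw [mul_smul, h, inv_smul_smul]⟩
  subst hxy
  exact ⟨rfl, aut_ext h⟩

theorem exists_smul_section (hf : IsAutQuotient M N f) (hs : ∀ x, f (s x) = x) (e : G ≃* M.aut)
    (φ : M.Flag) : ∃ x g, e g • s x = φ := by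
  obtain ⟨a, ha⟩ := hf.eq_iff.1 (hs (f φ))
  exact ⟨f φ, e.symm a, by rw [e.apply_symm_apply, ha]⟩

theorem r_smul_section (hv : ∀ i x, e (v i x) • s (N.r i x) = M.r i (s x)) (i : Fin 3) (g : G)
    (x : N.Flag) : M.r i (e g • s x) = e (g * v i x) • s (N.r i x) := by
  rw [← smul_r, ← hv, map_mul, mul_smul]

theorem eq_top_of_voltages_mem (hf : IsAutQuotient M N f) (hs : ∀ x, f (s x) = x)
    (hv : ∀ i x, e (v i x) • s (N.r i x) = M.r i (s x)) {K : Subgroup G} (hK : ∀ i x, v i x ∈ K) :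
    K = ⊤ := by
  rw [Subgroup.eq_top_iff']
  intro k
  obtain ⟨x₀⟩ := N.nonempty
  have mem_of_eq := flag_induction (φ₀ := s x₀) (P := fun φ => ∀ x g, e g • s x = φ → g ∈ K) ?_ ?_
    (e k • s x₀)
  · exact mem_of_eq x₀ k rfl
  · intro x g h
    rw [← one_smul M.aut (s x₀), smul_section_inj hf hs, map_eq_one_iff e e.injective] at h
    exact h.2 ▸ one_mem _
  · rintro i φ hφ x g h
    obtain ⟨y, l, rfl⟩ := hf.exists_smul_section hs e φ
    rw [r_smul_section hv, hf.smul_section_inj hs, e.injective.eq_iff] at h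
    exact h.2 ▸ mul_mem (hφ y l rfl) (hK i y)

theorem eq_self_of_compatible (hf : IsAutQuotient M N f) (hs : ∀ x, f (s x) = x)
    (hv : ∀ i x, e (v i x) • s (N.r i x) = M.r i (s x)) (α : G ≃* G) (τ : Equiv.Perm N.Flag)
    (hτ : ∀ i x, τ (N.r i x) = N.r i (τ x)) (hα : ∀ i x, α (v i x) = v i (τ x)) (x : N.Flag) :
    τ x = x := by
  let E : N.Flag × G ≃ M.Flag := Equiv.ofBijective (fun p => e p.2 • s p.1) ⟨fun p q h => by
    obtain ⟨h₁, h₂⟩ := (hf.smul_section_inj hs).1 h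
    exact Prod.ext h₁ (e.injective h₂), fun φ => by
    obtain ⟨x, g, h⟩ := hf.exists_smul_section hs e φ
    exact ⟨(x, g), h⟩⟩
  let b : Equiv.Perm M.Flag := E.permCongr (τ.prodCongr α.toEquiv)
  have b_smul (x g) : b (e g • s x) = e (α g) • s (τ x) := by
    rw [show e g • s x = E (x, g) from rfl, Equiv.permCongr_apply, Equiv.symm_apply_apply]
    rfl
  have b_mem : b ∈ M.aut := by
    refine mem_aut_iff.2 fun i φ => ?_
    obtain ⟨x, g, rfl⟩ := hf.exists_smul_section hs e φ
    rw [r_smul_section hv, b_smul, b_smul, r_smul_section hv, map_mul, hα, hτ]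
  have hbx : (⟨b, b_mem⟩ : M.aut) • s x = s (τ x) := by
    simpa using b_smul x 1
  rw [← hs (τ x), ← hbx, ← hf.eq_iff.2 ⟨⟨b, b_mem⟩, rfl⟩, hs]

/-- The last clause holds because an automorphism of the voltage group and one of the quotient
which are compatible with the voltages lift to an automorphism of the map. -/
theorem exists_voltage (hf : IsAutQuotient M N f) (hs : ∀ x, f (s x) = x) (e : G ≃* M.aut) :
    ∃ W : Voltage N G, (∀ K : Subgroup G, (∀ i x, W.v i x ∈ K) → K = ⊤) ∧
      (∀ i x, s (N.r i x) = M.r i (s x) → W.v i x = 1) ∧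
      ∀ (α : G ≃* G) (τ : Equiv.Perm N.Flag), (∀ i x, τ (N.r i x) = N.r i (τ x)) →
        (∀ i x, α (W.v i x) = W.v i (τ x)) → ∀ x, τ x = x := by
  have exists_v (i x) : ∃ g, e g • s (N.r i x) = M.r i (s x) := by
    obtain ⟨y, g, h⟩ := hf.exists_smul_section hs e (M.r i (s x))
    have : f (e g • s y) = f (s y) := (hf.eq_iff.2 ⟨_, rfl⟩).symm
    rw [h, hf.map_r, hs, hs] at this
    exact ⟨g, this ▸ h⟩
  choose v hv using exists_v
  have eq_of_smul {x y g k} (h : e g • s x = e k • s y) : g = k :=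
    e.injective ((hf.smul_section_inj hs).1 h).2
  refine ⟨⟨v, fun i x => ?_, fun x => ?_⟩, fun _ => hf.eq_top_of_voltages_mem hs hv,
    fun i x h => ?_, hf.eq_self_of_compatible hs hv⟩
  · refine eq_of_smul (x := x) (y := x) ?_
    have := r_smul_section hv i (v i x) (N.r i x)
    rw [hv, r_r, r_r] at this
    rw [← this, map_one, one_smul]
  · have h₂ := r_smul_section hv 2 (v 0 x) (N.r 0 x)
    have h₀ := r_smul_section hv 0 (v 2 x) (N.r 2 x)
    rw [hv] at h₀ h₂
    exact eq_of_smul (h₂.symm.trans ((r_zero_r_two M _).symm.trans h₀))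
  · exact eq_of_smul (x := N.r i x) (y := N.r i x) (by rw [hv, map_one, one_smul, h])

end FlagMap.IsAutQuotient

end Coverings

/-! ### Generators of the automorphism group -/

section GeneratorCriteria

open FlagMap Voltage

/-- The pair `(x, y)` is inverted entrywise by an automorphism of the group. For a generating pair
this is the algebraic form of an additional symmetry of a map. -/
def IsReflexible {G : Type*} [Group G] (x y : G) : Prop :=
  ∃ α : G ≃* G, α x = x⁻¹ ∧ α y = y⁻¹

theorem closure_inv_pair_eq_top {G : Type*} [Group G] {a b : G}
    (hgen : Subgroup.closure {a, b} = ⊤) : Subgroup.closure {a⁻¹, b⁻¹} = ⊤ := by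
  rw [← hgen, ← Subgroup.closure_inv]
  simp [Set.inv_insert]

variable {G : Type} [Group G] {a b c z : G}

theorem isRealised_one_iff : IsRealised .one G ↔ ∃ a₀ a₁ a₂ : G, a₀ * a₀ = 1 ∧ a₁ * a₁ = 1 ∧
    a₂ * a₂ = 1 ∧ a₀ * a₂ = a₂ * a₀ ∧ Subgroup.closure {a₀, a₁, a₂} = ⊤ := by
  constructor
  · rintro ⟨M, hM, ⟨e⟩⟩
    obtain ⟨f, hf⟩ := inClass_iff.1 hM
    have φ := M.nonempty.some
    obtain ⟨W, hW, -⟩ := hf.exists_voltage (s := fun _ => φ) (fun _ => rfl) e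
    refine ⟨W.v 0 (), W.v 1 (), W.v 2 (), W.mul_v 0 (), W.mul_v 1 (), W.mul_v 2 (), W.comm (), ?_⟩
    refine hW _ fun i _ => Subgroup.subset_closure ?_
    fin_cases i
    exacts [Or.inl rfl, Or.inr (Or.inl rfl), Or.inr (Or.inr rfl)]
  · rintro ⟨a₀, a₁, a₂, h₀, h₁, h₂, hcomm, hgen⟩
    let W : Voltage EdgeClass.one.basicMap G :=
      { v := ![fun _ => a₀, fun _ => a₁, fun _ => a₂]
        mul_v := fun i _ => by fin_cases i <;> assumption
        comm := fun _ => hcomm }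
    refine isRealised_of_loops (W := W) (x₀ := ()) (c := ![a₀, a₁, a₂]) W.lift W.lift_mem_mon
      (fun i g => ?_) ?_ fun _ _ _ _ => rfl
    · fin_cases i <;> rfl
    · rw [Matrix.range_cons, Matrix.range_cons_cons_empty, Set.singleton_union, hgen]

theorem isRealised_two (ha : a * a = 1) (hb : b * b = 1) (hc : c * c = 1)
    (hgen : Subgroup.closure {a, b, c} = ⊤) (hno : ¬ ∃ α : G ≃* G, α a = a ∧ α b = c ∧ α c = b) :
    IsRealised (.two .empty) G := by
  let W : Voltage (EdgeClass.two .empty).basicMap G :=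
    { v := ![fun _ => 1, fun x : Bool => bif x then c else b, fun _ => a]
      mul_v := fun i x => by fin_cases i <;> cases x <;> first | assumption | exact mul_one 1
      comm := fun _ => (one_mul a).trans (mul_one a).symm }
  let w : Fin 3 → Equiv.Perm (Bool × G) := ![W.lift 2, W.lift 1, W.lift 0 * W.lift 1 * W.lift 0]
  have w_mem (i) : w i ∈ W.mon := by
    have h := W.lift_mem_mon
    fin_cases i
    exacts [h 2, h 1, mul_mem (mul_mem (h 0) (h 1)) (h 0)]
  have w_false (i g) : w i (false, g) = (false, g * ![a, b, c] i) := by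
    fin_cases i
    exacts [rfl, rfl, Prod.ext rfl (show g * 1 * c * 1 = g * c by group)]
  have w_true (i g) : w i (true, g) = (true, g * ![a, c, b] i) := by
    fin_cases i
    exacts [rfl, rfl, Prod.ext rfl (show g * 1 * b * 1 = g * b by group)]
  have range_vec (x y z : G) : Set.range ![x, y, z] = {x, y, z} := by
    rw [Matrix.range_cons, Matrix.range_cons_cons_empty, Set.singleton_union]
  have hgen_false : Subgroup.closure (Set.range ![a, b, c]) = ⊤ := by rw [range_vec, hgen]
  have hgen_true : Subgroup.closure (Set.range ![a, c, b]) = ⊤ := by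
    rw [range_vec, Set.pair_comm, hgen]
  refine isRealised_of_loops w w_mem w_false hgen_false ?_
  rintro τ hτ (_ | _) h
  · rfl
  · obtain ⟨α, hα⟩ := exists_mulEquiv_of_commute (fun i => hτ _ (w_mem i)) w_false w_true h
      hgen_false hgen_true
    exact (hno ⟨α, hα 0, hα 1, hα 2⟩).elim

theorem isRealised_twoEx (ha : a * a = 1) (hgen : Subgroup.closure {a, z} = ⊤)
    (hno : ¬ IsReflexible a z) : IsRealised (.twoEx .empty) G := by
  let W : Voltage (EdgeClass.twoEx .empty).basicMap G :=
    { v := ![fun _ => 1, fun x : Bool => bif x then z⁻¹ else z, fun _ => a]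
      mul_v := fun i x => by
        fin_cases i <;> cases x
        exacts [mul_one 1, mul_one 1, mul_inv_cancel z, inv_mul_cancel z, ha, ha]
      comm := fun _ => (one_mul a).trans (mul_one a).symm }
  let w : Fin 2 → Equiv.Perm (Bool × G) := ![W.lift 2, W.lift 0 * W.lift 1]
  have w_mem (i) : w i ∈ W.mon := by
    have h := W.lift_mem_mon
    fin_cases i
    exacts [h 2, mul_mem (h 0) (h 1)]
  have w_false (i g) : w i (false, g) = (false, g * ![a, z] i) := by
    fin_cases i
    exacts [rfl, Prod.ext rfl (mul_one _)]
  have w_true (i g) : w i (true, g) = (true, g * ![a⁻¹, z⁻¹] i) := by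
    fin_cases i
    exacts [Prod.ext rfl (congrArg (g * ·) (inv_eq_of_mul_eq_one_left ha).symm),
      Prod.ext rfl (mul_one _)]
  have hgen_false : Subgroup.closure (Set.range ![a, z]) = ⊤ := by
    rw [Matrix.range_cons_cons_empty, hgen]
  have hgen_true : Subgroup.closure (Set.range ![a⁻¹, z⁻¹]) = ⊤ := by
    rw [Matrix.range_cons_cons_empty, closure_inv_pair_eq_top hgen]
  refine isRealised_of_loops w w_mem w_false hgen_false ?_
  rintro τ hτ (_ | _) h
  · rfl
  · obtain ⟨α, hα⟩ := exists_mulEquiv_of_commute (fun i => hτ _ (w_mem i)) w_false w_true h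
      hgen_false hgen_true
    exact (hno ⟨α, hα 0, hα 1⟩).elim

theorem IsRealised.exists_generators_twoEx (h : IsRealised (.twoEx .empty) G) :
    ∃ a z : G, a * a = 1 ∧ Subgroup.closure {a, z} = ⊤ ∧ ¬ IsReflexible a z := by
  obtain ⟨M, hM, ⟨e⟩⟩ := h
  obtain ⟨f, hf⟩ := inClass_iff.1 hM
  obtain ⟨φ, hφ⟩ := hf.surjective false
  have hφ₀ : f (M.r 0 φ) = true := by rw [hf.map_r, hφ]; rfl
  obtain ⟨W, hW, v_eq_one, no_symm⟩ := hf.exists_voltage (s := fun x => bif x then M.r 0 φ else φ)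
    (by rintro (_ | _) <;> assumption) e
  have hv₀ (x : Bool) : W.v 0 x = 1 := by
    refine v_eq_one 0 x ?_
    cases x
    exacts [rfl, (r_r M 0 φ).symm]
  have hv₁ : W.v 1 true = (W.v 1 false)⁻¹ := eq_inv_of_mul_eq_one_right (W.mul_v 1 false)
  have hv₂ : W.v 2 true = W.v 2 false := by
    have : W.v 0 false * W.v 2 true = W.v 2 false * W.v 0 false := W.comm false
    rwa [hv₀, one_mul, mul_one] at this
  have hsq : W.v 2 false * W.v 2 false = 1 := W.mul_v 2 false
  refine ⟨W.v 2 false, W.v 1 false, hsq, ?_, fun ⟨α, hα₂, hα₁⟩ => ?_⟩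
  · have mem₁ : W.v 1 false ∈ Subgroup.closure {W.v 2 false, W.v 1 false} :=
      Subgroup.subset_closure (Or.inr rfl)
    have mem₂ : W.v 2 false ∈ Subgroup.closure {W.v 2 false, W.v 1 false} :=
      Subgroup.subset_closure (Or.inl rfl)
    refine hW _ fun i (x : Bool) => ?_
    fin_cases i <;> cases x
    exacts [hv₀ false ▸ one_mem _, hv₀ true ▸ one_mem _, mem₁, hv₁ ▸ inv_mem mem₁, mem₂,
      hv₂ ▸ mem₂]
  · rw [inv_eq_of_mul_eq_one_left hsq] at hα₂
    have map_v (i) (x : Bool) : α (W.v i x) = W.v i (!x) := by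
      fin_cases i <;> cases x <;> simp [hv₀, hv₁, hv₂, hα₁, hα₂]
    exact Bool.noConfusion (no_symm α Equiv.boolNot
      (fun i x => by fin_cases i <;> cases x <;> rfl) map_v false)

theorem isRealised_three (ha : a * a = 1) (hb : b * b = 1) (hc : c * c = 1) (ha₁ : a ≠ 1)
    (hb₁ : b ≠ 1) (hc₁ : c ≠ 1) (hgen : Subgroup.closure {a, b, c} = ⊤) :
    IsRealised .three G := by
  let v : Bool × Bool → G
    | (false, false) => 1
    | (false, true) => a
    | (true, false) => b
    | (true, true) => c
  let W : Voltage EdgeClass.three.basicMap G :=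
    { v := ![fun _ => 1, v, fun _ => 1]
      mul_v := by
        rintro i ⟨_ | _, _ | _⟩ <;> fin_cases i <;> first | assumption | exact mul_one 1
      comm := fun _ => rfl }
  let w : Fin 3 → Equiv.Perm ((Bool × Bool) × G) := ![W.lift 2 * W.lift 1 * W.lift 2,
    W.lift 0 * W.lift 1 * W.lift 0, W.lift 0 * W.lift 2 * W.lift 1 * W.lift 2 * W.lift 0]
  have w_mem (i) : w i ∈ W.mon := by
    have h := W.lift_mem_mon
    fin_cases i
    exacts [mul_mem (mul_mem (h 2) (h 1)) (h 2), mul_mem (mul_mem (h 0) (h 1)) (h 0),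
      mul_mem (mul_mem (mul_mem (mul_mem (h 0) (h 2)) (h 1)) (h 2)) (h 0)]
  have w_apply (i g) : w i ((false, false), g) = ((false, false), g * ![a, b, c] i) := by
    fin_cases i
    exacts [Prod.ext rfl (show g * 1 * a * 1 = g * a by group),
      Prod.ext rfl (show g * 1 * b * 1 = g * b by group),
      Prod.ext rfl (show g * 1 * 1 * c * 1 * 1 = g * c by group)]
  refine isRealised_of_loops w w_mem w_apply ?_ fun τ hτ y h => ?_
  · rw [Matrix.range_cons, Matrix.range_cons_cons_empty, Set.singleton_union, hgen]
  · have hfix : W.lift 1 (y, 1) = (y, 1) := by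
      rw [← h, ← hτ _ (W.lift_mem_mon 1)]
      exact congrArg τ (Prod.ext rfl (mul_one 1))
    have hv : 1 * v y = 1 := congrArg Prod.snd hfix
    rw [one_mul] at hv
    rcases y with ⟨_ | _, _ | _⟩
    exacts [rfl, (ha₁ hv).elim, (hb₁ hv).elim, (hc₁ hv).elim]

theorem isRealised_four (hb : b * b = 1) (hb₁ : b ≠ 1) (hgen : Subgroup.closure {b, z} = ⊤) :
    IsRealised (.four .empty) G := by
  let v : Bool × Bool → G
    | (false, false) => z
    | (false, true) => z⁻¹
    | (true, false) => b
    | (true, true) => 1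
  let W : Voltage (EdgeClass.four .empty).basicMap G :=
    { v := ![fun _ => 1, v, fun _ => 1]
      mul_v := by
        rintro i ⟨_ | _, _ | _⟩ <;> fin_cases i <;>
          first | exact hb | exact mul_one 1 | exact mul_inv_cancel z | exact inv_mul_cancel z
      comm := fun _ => rfl }
  let w : Fin 2 → Equiv.Perm ((Bool × Bool) × G) :=
    ![W.lift 2 * W.lift 1 * W.lift 2, W.lift 0 * W.lift 1 * W.lift 2 * W.lift 0]
  have w_mem (i) : w i ∈ W.mon := by
    have h := W.lift_mem_mon
    fin_cases i
    exacts [mul_mem (mul_mem (h 2) (h 1)) (h 2),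
      mul_mem (mul_mem (mul_mem (h 0) (h 1)) (h 2)) (h 0)]
  have w_apply (i g) : w i ((true, true), g) = ((true, true), g * ![b, z] i) := by
    fin_cases i
    exacts [Prod.ext rfl (show g * 1 * b * 1 = g * b by group),
      Prod.ext rfl (show g * 1 * 1 * z * 1 = g * z by group)]
  refine isRealised_of_loops w w_mem w_apply ?_ fun τ hτ y h => ?_
  · rw [Matrix.range_cons_cons_empty, hgen]
  · have hfix : W.lift 1 (y, 1) = (y, 1) := by
      rw [← h, ← hτ _ (W.lift_mem_mon 1)]
      exact congrArg τ (Prod.ext rfl (mul_one 1))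
    have hr : (EdgeClass.four .empty).basicMap.r 1 y = y := congrArg Prod.fst hfix
    have hv : 1 * v y = 1 := congrArg Prod.snd hfix
    rw [one_mul] at hv
    rcases y with ⟨_ | _, _ | _⟩
    exacts [Bool.noConfusion (congrArg Prod.snd hr), Bool.noConfusion (congrArg Prod.snd hr),
      (hb₁ hv).elim, rfl]

/-- The voltages on the basic map of class `5` which are trivial along its edge: those of `r₁` are
`a`, `a⁻¹` and `b`, `b⁻¹` at its two pairs of flags. -/
def fiveVoltage (a b : G) : Voltage (EdgeClass.five .empty).basicMap G where
  v := ![fun _ => 1, fun x : Bool × Bool =>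
    bif x.2 then (bif x.1 then b else a)⁻¹ else bif x.1 then b else a, fun _ => 1]
  mul_v := by
    rintro i ⟨_ | _, _ | _⟩ <;> fin_cases i <;>
      first | exact mul_one 1 | exact mul_inv_cancel _ | exact inv_mul_cancel _
  comm _ := rfl

theorem exists_walks_fiveVoltage (a b : G) : ∃ w : Fin 2 → Equiv.Perm ((Bool × Bool) × G),
    (∀ i, w i ∈ (fiveVoltage a b).mon) ∧ ∀ x y i g, w i ((x, y), g) =
      ((x, y), g * ![(fiveVoltage a b).v 1 (x, y), (fiveVoltage a b).v 1 (!x, y)] i) := by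
  let R : Fin 3 → Equiv.Perm ((Bool × Bool) × G) := (fiveVoltage a b).lift
  have R_zero (x y g) : R 0 ((x, y), g) = ((!x, y), g) := Prod.ext rfl (mul_one g)
  have R_one (x y g) : R 1 ((x, y), g) = ((x, !y), g * (fiveVoltage a b).v 1 (x, y)) := rfl
  have R_two (x y g) : R 2 ((x, y), g) = ((x, !y), g) := Prod.ext rfl (mul_one g)
  refine ⟨![R 2 * R 1, R 0 * R 2 * R 1 * R 0], fun i => ?_, fun x y i g => ?_⟩
  · have h := (fiveVoltage a b).lift_mem_mon
    fin_cases i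
    exacts [mul_mem (h 2) (h 1), mul_mem (mul_mem (mul_mem (h 0) (h 2)) (h 1)) (h 0)]
  · fin_cases i
    · change R 2 (R 1 ((x, y), g)) = _
      rw [R_one, R_two, Bool.not_not]
      rfl
    · change R 0 (R 2 (R 1 (R 0 ((x, y), g)))) = _
      rw [R_zero, R_one, R_two, R_zero, Bool.not_not, Bool.not_not]
      rfl

theorem isRealised_five (hgen : Subgroup.closure {a, b} = ⊤) (hno : ¬ IsReflexible a b)
    (hab : orderOf a ≠ orderOf b) : IsRealised (.five .empty) G := by
  set v := (fiveVoltage a b).v 1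
  obtain ⟨w, w_mem, w_apply⟩ := exists_walks_fiveVoltage a b
  have hgen' (x y : Bool) : Subgroup.closure (Set.range ![v (x, y), v (!x, y)]) = ⊤ := by
    rw [Matrix.range_cons_cons_empty]
    cases x <;> cases y
    · exact hgen
    · exact closure_inv_pair_eq_top hgen
    · exact (congrArg _ (Set.pair_comm b a)).trans hgen
    · exact (congrArg _ (Set.pair_comm b⁻¹ a⁻¹)).trans (closure_inv_pair_eq_top hgen)
  refine isRealised_of_loops w w_mem (w_apply false false) (hgen' false false) ?_
  rintro τ hτ ⟨x, y⟩ h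
  obtain ⟨α, hα⟩ := exists_mulEquiv_of_commute (fun i => hτ _ (w_mem i))
    (w_apply false false) (w_apply x y) h (hgen' false false) (hgen' x y)
  have hαa : α a = v (x, y) := hα 0
  have hαb : α b = v (!x, y) := hα 1
  have horder : orderOf a = orderOf (v (x, y)) := by rw [← hαa, MulEquiv.orderOf_eq]
  cases x <;> cases y
  exacts [rfl, (hno ⟨α, hαa, hαb⟩).elim, (hab horder).elim,
    (hab (horder.trans (orderOf_inv b))).elim]

theorem FlagMap.IsAutQuotient.exists_section_five {M : FlagMap} {f : M.Flag → Bool × Bool}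
    (hf : IsAutQuotient M (EdgeClass.five .empty).basicMap f) :
    ∃ s : Bool × Bool → M.Flag, (∀ x, f (s x) = x) ∧ (∀ x, s (fourFlag₀ x) = M.r 0 (s x)) ∧
      ∀ x, s (fourFlag₂ x) = M.r 2 (s x) := by
  obtain ⟨φ, hφ⟩ := hf.surjective (false, false)
  let s : Bool × Bool → M.Flag
    | (false, false) => φ
    | (false, true) => M.r 2 φ
    | (true, false) => M.r 0 φ
    | (true, true) => M.r 2 (M.r 0 φ)
  refine ⟨s, ?_, ?_, ?_⟩
  · rintro ⟨_ | _, _ | _⟩ <;> simp only [s, hf.map_r, hφ] <;> rfl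
  · rintro ⟨_ | _, _ | _⟩
    exacts [rfl, (r_zero_r_two M φ).symm, (r_r M 0 φ).symm,
      ((r_zero_r_two M _).trans (congrArg (M.r 2) (r_r M 0 φ))).symm]
  · rintro ⟨_ | _, _ | _⟩
    exacts [rfl, (r_r M 2 φ).symm, rfl, (r_r M 2 _).symm]

theorem IsRealised.exists_generators_five (h : IsRealised (.five .empty) G) :
    ∃ a b : G, Subgroup.closure {a, b} = ⊤ ∧ ¬ IsReflexible a b := by
  obtain ⟨M, hM, ⟨e⟩⟩ := h
  obtain ⟨f, hf⟩ := inClass_iff.1 hM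
  obtain ⟨s, hs, hs₀, hs₂⟩ := hf.exists_section_five
  obtain ⟨W, hW, v_eq_one, no_symm⟩ := hf.exists_voltage hs e
  have hv₀ (x : Bool × Bool) : W.v 0 x = 1 := v_eq_one 0 x (hs₀ x)
  have hv₂ (x : Bool × Bool) : W.v 2 x = 1 := v_eq_one 2 x (hs₂ x)
  have hv₁ (x : Bool) : W.v 1 (x, true) = (W.v 1 (x, false))⁻¹ :=
    eq_inv_of_mul_eq_one_right (W.mul_v 1 (x, false))
  refine ⟨W.v 1 (false, false), W.v 1 (true, false), ?_, fun ⟨α, hα₀, hα₁⟩ => ?_⟩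
  · set K := Subgroup.closure {W.v 1 (false, false), W.v 1 (true, false)}
    have mem₀ : W.v 1 (false, false) ∈ K := Subgroup.subset_closure (Or.inl rfl)
    have mem₁ : W.v 1 (true, false) ∈ K := Subgroup.subset_closure (Or.inr rfl)
    refine hW _ fun i (x : Bool × Bool) => ?_
    fin_cases i
    · exact hv₀ x ▸ one_mem K
    · rcases x with ⟨_ | _, _ | _⟩
      exacts [mem₀, hv₁ false ▸ inv_mem mem₀, mem₁, hv₁ true ▸ inv_mem mem₁]
    · exact hv₂ x ▸ one_mem K
  · have map_v (i) (x : Bool × Bool) : α (W.v i x) = W.v i (fourFlag₂ x) := by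
      fin_cases i
      · exact (congrArg α (hv₀ x)).trans ((map_one α).trans (hv₀ _).symm)
      · rcases x with ⟨_ | _, _ | _⟩ <;> simp [fourFlag₂, hv₁, hα₀, hα₁]
      · exact (congrArg α (hv₂ x)).trans ((map_one α).trans (hv₂ _).symm)
    exact Bool.noConfusion (congrArg Prod.snd (no_symm α fourFlag₂
      (by rintro i ⟨_ | _, _ | _⟩ <;> fin_cases i <;> rfl) map_v (false, false)))

end GeneratorCriteria

/-! ### Generators of alternating groups -/

section AlternatingGenerators

open Equiv Equiv.Perm
open scoped Pointwise

section Generation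

variable {α ι : Type*}

/-- Every point arises from `p` by repeated application of the permutations `x i`. For finite `α`
this is transitivity of the group they generate, in a form suited to induction on points. -/
def Reaches (x : ι → Perm α) (p : α) : Prop :=
  ∀ P : α → Prop, P p → (∀ i y, P y → P (x i y)) → ∀ y, P y

theorem reaches_of_rank {x : ι → Perm α} {p : α} (rk : α → ℕ)
    (h : ∀ y, y = p ∨ ∃ i, rk ((x i)⁻¹ y) < rk y) : Reaches x p := by
  intro P hp hP y
  induction hk : rk y using Nat.strong_induction_on generalizing y with
  | _ k ih =>
    rcases h y with rfl | ⟨i, hlt⟩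
    · exact hp
    · have := hP i _ (ih _ (hk ▸ hlt) _ rfl)
      rwa [← Perm.mul_apply, mul_inv_cancel, Perm.one_apply] at this

theorem Reaches.isPretransitive {x : ι → Perm α} {p : α} (h : Reaches x p) :
    MulAction.IsPretransitive (Subgroup.closure (Set.range x)) α := by
  have hp : ∀ y, ∃ g : Subgroup.closure (Set.range x), g • p = y := by
    refine h _ ⟨1, one_smul _ p⟩ ?_
    rintro i _ ⟨g, rfl⟩
    exact ⟨⟨x i, Subgroup.subset_closure ⟨i, rfl⟩⟩ * g, mul_smul _ g p⟩
  refine ⟨fun y z => ?_⟩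
  obtain ⟨g, rfl⟩ := hp y
  obtain ⟨k, rfl⟩ := hp z
  exact ⟨k * g⁻¹, by rw [mul_smul, inv_smul_smul]⟩

/-- The support of `T` meets its image under `r`, so that `r` cannot move a block containing this
support to a disjoint one. -/
def Overlaps (T r : Perm α) : Prop :=
  ∃ y, T y ≠ y ∧ T (r y) ≠ r y

instance [Fintype α] [DecidableEq α] (T r : Perm α) : Decidable (Overlaps T r) :=
  inferInstanceAs (Decidable (∃ y, T y ≠ y ∧ T (r y) ≠ r y))

variable {G : Subgroup (Perm α)} {B : Set α}

theorem smul_eq_of_isBlock (hB : MulAction.IsBlock G B) {g : Perm α} (hg : g ∈ G) {y : α}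
    (hy : y ∈ B) (hgy : g y ∈ B) : g • B = B :=
  MulAction.IsBlock.smul_eq_of_mem (g := (⟨g, hg⟩ : G)) hB hy hgy

theorem support_subset_of_isBlock (hB : MulAction.IsBlock G B) (hB' : B.Nontrivial) {T : Perm α}
    (hT : T.IsCycle) (hT' : (orderOf T).Prime) (hTG : T ∈ G) {a : α} (ha : a ∈ B) (hTa : T a ≠ a)
    {y : α} (hy : T y ≠ y) : y ∈ B := by
  have smul_eq : T • B = B := by
    obtain ⟨d, hd, hda⟩ := hB'.exists_ne a
    by_cases hTd : T d = d
    · exact smul_eq_of_isBlock hB hTG hd (hTd.symm ▸ hd)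
    -- A power of `T` taking `a` to `d` preserves `B`, and it generates the group of powers of `T`.
    obtain ⟨k, hk⟩ := hT.exists_zpow_eq hTa hTd
    have hTk : T ^ k • B = B :=
      smul_eq_of_isBlock hB (zpow_mem hTG k) ha (hk.symm ▸ hd)
    have := Fact.mk (Nat.card_zpowers T ▸ hT')
    have hne : T ^ k ≠ 1 := fun h => hda (by rw [← hk, h, one_apply])
    obtain ⟨m, hm⟩ := mem_zpowers_of_prime_card (G := Subgroup.zpowers T) (g := ⟨T ^ k, k, rfl⟩)
      (g' := ⟨T, Subgroup.mem_zpowers T⟩) rfl (fun h => hne (congrArg Subtype.val h))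
    have hm' : (T ^ k) ^ m = T := congrArg Subtype.val hm
    rw [← hm']
    exact zpow_mem (K := MulAction.stabilizer (Perm α) B) hTk m
  obtain ⟨k, rfl⟩ := hT.exists_zpow_eq hTa hy
  have : T ^ k • B = B := zpow_mem (K := MulAction.stabilizer (Perm α) B) smul_eq k
  rw [← this]
  exact ⟨a, ha, rfl⟩

theorem isPreprimitive_closure {x : ι → Perm α} {p : α} (hx : Reaches x p) {T : Perm α}
    (hT : T.IsCycle) (hT' : (orderOf T).Prime) (hmem : T ∈ Subgroup.closure (Set.range x))
    (hover : ∀ i, Overlaps T (x i)) :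
    MulAction.IsPreprimitive (Subgroup.closure (Set.range x)) α := by
  have := hx.isPretransitive
  obtain ⟨a, ha, -⟩ := id hT
  refine MulAction.IsPreprimitive.of_isTrivialBlock_base a fun {B} haB hB => ?_
  refine or_iff_not_imp_left.2 fun hB' => ?_
  have support_subset {y : α} (hy : T y ≠ y) : y ∈ B :=
    support_subset_of_isBlock hB (Set.not_subsingleton_iff.1 hB') hT hT' hmem haB ha hy
  have hle : Subgroup.closure (Set.range x) ≤ MulAction.stabilizer (Perm α) B := by
    rw [Subgroup.closure_le]
    rintro _ ⟨i, rfl⟩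
    obtain ⟨y, hy, hxy⟩ := hover i
    exact smul_eq_of_isBlock hB (Subgroup.subset_closure ⟨i, rfl⟩) (support_subset hy)
      (support_subset hxy)
  refine Set.eq_univ_of_forall fun y => ?_
  obtain ⟨g, rfl⟩ := MulAction.exists_smul_eq (Subgroup.closure (Set.range x)) a y
  have hg : (g : Perm α) • B = B := hle g.2
  rw [← hg]
  exact ⟨a, haB, rfl⟩

variable [Fintype α] [DecidableEq α]

theorem alternatingGroup_le_closure {x : ι → Perm α} {p : α} (hx : Reaches x p) {T : Perm α}
    (hT : T.IsThreeCycle) (hmem : T ∈ Subgroup.closure (Set.range x))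
    (hover : ∀ i, Overlaps T (x i)) : alternatingGroup α ≤ Subgroup.closure (Set.range x) :=
  alternatingGroup_le_of_isPreprimitive_of_isThreeCycle_mem
    (isPreprimitive_closure hx hT.isCycle (hT.orderOf.symm ▸ Nat.prime_three) hmem hover) hT hmem

theorem closure_range_eq_top {x : ι → alternatingGroup α} {y : ι → Perm α}
    (hxy : ∀ i, (x i : Perm α) = y i) {p : α} (hy : Reaches y p) {T : Perm α}
    (hT : T.IsThreeCycle) (hmem : T ∈ Subgroup.closure (Set.range y))
    (hover : ∀ i, Overlaps T (y i)) : Subgroup.closure (Set.range x) = ⊤ := by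
  obtain rfl : (fun i => (x i : Perm α)) = y := funext hxy
  apply Subgroup.map_injective (alternatingGroup α).subtype_injective
  rw [MonoidHom.map_closure, ← Set.range_comp, ← MonoidHom.range_eq_map, Subgroup.range_subtype]
  refine le_antisymm ((Subgroup.closure_le _).2 ?_) (alternatingGroup_le_closure hy hT hmem hover)
  rintro _ ⟨i, rfl⟩
  exact (x i).2

theorem freeGroup_lift_mem_closure {G : Type*} [Group G] (x : ι → G) (D : FreeGroup ι) :
    FreeGroup.lift x D ∈ Subgroup.closure (Set.range x) :=
  FreeGroup.range_lift_eq_closure (f := x) ▸ ⟨D, rfl⟩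

theorem closure_range_eq_top_of_word {k : ℕ} (x : Fin k → alternatingGroup α) (p : α) (rk : α → ℕ)
    (T : Perm α) (w : List (Fin k × Bool)) (m : ℕ)
    (h : (∀ y, y = p ∨ ∃ i, rk ((x i : Perm α)⁻¹ y) < rk y) ∧ T.support.card = 3 ∧
      FreeGroup.lift (fun i => (x i : Perm α)) (FreeGroup.mk w) ^ m = T ∧
      ∀ i, Overlaps T (x i)) : Subgroup.closure (Set.range x) = ⊤ := by
  obtain ⟨hrk, hT, hw, hover⟩ := h
  exact closure_range_eq_top (fun _ => rfl) (reaches_of_rank rk hrk)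
    (card_support_eq_three_iff.1 hT) (hw ▸ pow_mem (freeGroup_lift_mem_closure _ _) m) hover

end Generation

section Path

variable {α : Type*}

/-- A permutation extended by the identity on four more points. -/
def extendFour : Perm α →* Perm (α ⊕ Fin 4) :=
  (sumCongrHom α (Fin 4)).comp (MonoidHom.inl _ _)

@[simp]
theorem extendFour_inl (f : Perm α) (y : α) : extendFour f (Sum.inl y) = Sum.inl (f y) := rfl

@[simp]
theorem extendFour_inr (f : Perm α) (i : Fin 4) : extendFour f (Sum.inr i) = Sum.inr i := rfl

theorem extendFour_injective : Function.Injective (extendFour (α := α)) := fun _ _ h =>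
  Equiv.ext fun y => Sum.inl_injective (DFunLike.congr_fun h (Sum.inl y))

theorem Overlaps.extendFour {T f : Perm α} (h : Overlaps T f) {g : Perm (α ⊕ Fin 4)}
    (hg : ∀ y, T y ≠ y → g (Sum.inl y) = Sum.inl (f y)) :
    Overlaps (extendFour T) g := by
  obtain ⟨y, hy, hfy⟩ := h
  refine ⟨Sum.inl y, by simpa using hy, ?_⟩
  rw [hg y hy]
  simpa using hfy

variable [DecidableEq α]

theorem swap_mul_swap_mul_self {a b c d : α} (h : [a, b, c, d].Nodup) :
    swap a b * swap c d * (swap a b * swap c d) = 1 := by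
  rw [(disjoint_swap_swap h).commute.symm.mul_mul_mul_comm, swap_mul_self, swap_mul_self, one_mul]

/-- The edges of one colour on the path `p, 0, 1, 2, 3`. -/
def pathEven (p : α) : Perm (α ⊕ Fin 4) :=
  swap (Sum.inl p) (Sum.inr 0) * swap (Sum.inr 1) (Sum.inr 2)

/-- The edges of the other colour on the path `p, 0, 1, 2, 3`. -/
def pathOdd : Perm (α ⊕ Fin 4) :=
  swap (Sum.inr 0) (Sum.inr 1) * swap (Sum.inr 2) (Sum.inr 3)

theorem pathEven_mul_self (p : α) : pathEven p * pathEven p = 1 :=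
  swap_mul_swap_mul_self (by simp)

theorem pathOdd_mul_self : (pathOdd : Perm (α ⊕ Fin 4)) * pathOdd = 1 :=
  swap_mul_swap_mul_self (by simp)

theorem commute_pathEven {f : Perm α} {p : α} (hf : f p = p) :
    Commute (extendFour f) (pathEven p) := by
  refine Commute.mul_right ?_ ?_ <;>
    rw [commute_iff_eq, mul_swap_eq_swap_mul] <;> simp only [extendFour_inl, extendFour_inr, hf]

theorem commute_pathOdd (f : Perm α) : Commute (extendFour f) pathOdd := by
  refine Commute.mul_right ?_ ?_ <;>
    rw [commute_iff_eq, mul_swap_eq_swap_mul] <;> simp only [extendFour_inr]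

theorem pathEven_inl {p y : α} (hy : y ≠ p) : pathEven p (Sum.inl y) = Sum.inl y := by
  simp [pathEven, swap_apply_def, hy]

theorem pathOdd_inl (y : α) : pathOdd (Sum.inl y : α ⊕ Fin 4) = Sum.inl y := by
  simp [pathOdd, swap_apply_def]

theorem pathEven_zero (p : α) : pathEven p (Sum.inr 0) = Sum.inl p := by
  simp [pathEven, swap_apply_def]

theorem pathEven_two (p : α) : pathEven p (Sum.inr 2) = Sum.inr 1 := by
  simp [pathEven, swap_apply_def]

theorem pathEven_three (p : α) : pathEven p (Sum.inr 3) = Sum.inr 3 := by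
  simp [pathEven, swap_apply_def]

theorem pathOdd_three : pathOdd (Sum.inr 3 : α ⊕ Fin 4) = Sum.inr 2 := by
  simp [pathOdd, swap_apply_def]

theorem pathOdd_one : pathOdd (Sum.inr 1 : α ⊕ Fin 4) = Sum.inr 0 := by
  simp [pathOdd, swap_apply_def]

theorem Reaches.attachPath {ι : Type*} {x : ι → Perm α} {x' : ι → Perm (α ⊕ Fin 4)} {p : α}
    (hx : Reaches x p) {i j : ι} (hp : x i p = p) (hi : x' i = extendFour (x i) * pathEven p)
    (hj : x' j = extendFour (x j) * pathOdd)
    (hx' : ∀ k, k = i ∨ k = j ∨ x' k = extendFour (x k)) : Reaches x' (Sum.inr 3) := by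
  intro P h₃ hP
  have even {y} (hy : P y) : P (extendFour (x i) (pathEven p y)) := by
    rw [← Perm.mul_apply, ← hi]
    exact hP i y hy
  have odd {y} (hy : P y) : P (extendFour (x j) (pathOdd y)) := by
    rw [← Perm.mul_apply, ← hj]
    exact hP j y hy
  have h₂ : P (Sum.inr 2) := by simpa only [pathOdd_three, extendFour_inr] using odd h₃
  have h₁ : P (Sum.inr 1) := by simpa only [pathEven_two, extendFour_inr] using even h₂
  have h₀ : P (Sum.inr 0) := by simpa only [pathOdd_one, extendFour_inr] using odd h₁
  have hp' : P (Sum.inl p) := by simpa only [pathEven_zero, extendFour_inl, hp] using even h₀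
  have hα : ∀ y, P (Sum.inl y) := by
    refine hx (fun y => P (Sum.inl y)) hp' fun k y hy => ?_
    rcases hx' k with rfl | rfl | hk
    · by_cases hyp : y = p
      · rwa [hyp, hp]
      · simpa only [pathEven_inl hyp, extendFour_inl] using even hy
    · simpa only [pathOdd_inl, extendFour_inl] using odd hy
    · simpa only [hk, extendFour_inl] using hP k _ hy
  rintro (y | i)
  · exact hα y
  · fin_cases i <;> assumption

variable [Fintype α]

theorem sign_extendFour (f : Perm α) : sign (extendFour f) = sign f := by
  refine (sign_sumCongr f 1).trans ?_
  rw [map_one, mul_one]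

theorem sign_pathEven (p : α) : sign (pathEven p) = 1 := by
  rw [pathEven, Perm.sign_mul, sign_swap Sum.inl_ne_inr, sign_swap (by simp)]; rfl

theorem sign_pathOdd : sign (pathOdd : Perm (α ⊕ Fin 4)) = 1 := by
  rw [pathOdd, Perm.sign_mul, sign_swap (by simp), sign_swap (by simp)]; rfl

theorem isThreeCycle_extendFour {T : Perm α} (hT : T.IsThreeCycle) :
    (extendFour T).IsThreeCycle := by
  rw [← card_support_eq_three_iff] at hT ⊢
  rw [← hT, ← Finset.card_map (Function.Embedding.inl (β := Fin 4)) (s := T.support)]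
  refine congrArg Finset.card (Finset.ext ?_)
  rintro (y | i) <;> simp

end Path

section Triples

theorem mul_conj_of_commute {G : Type*} [Group G] {a b e : G} (ha : Commute a e)
    (hb : Commute b e) (he : e * e = 1) : a * e * b * (a * e) = a * b * a := by
  rw [mul_assoc a e b, ← hb.eq, mul_assoc, mul_assoc, ← mul_assoc e a e, ← ha.eq, mul_assoc a e e,
    he, mul_one, mul_assoc]

variable {α : Type*} [Fintype α] [DecidableEq α]

/-- Even involutions `r₀, r₁, r₂`, the first and the last commuting, which generate the alternating
group and to which a path can be attached at `p`: the properties below are inherited by the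
extensions of these permutations to the longer set, and so is the 3-cycle `T`. -/
structure IsExtensibleTriple (p : α) (r₀ r₁ r₂ T : Perm α) : Prop where
  sign₀ : sign r₀ = 1
  sign₁ : sign r₁ = 1
  sign₂ : sign r₂ = 1
  sq₀ : r₀ * r₀ = 1
  sq₁ : r₁ * r₁ = 1
  sq₂ : r₂ * r₂ = 1
  comm : r₀ * r₂ = r₂ * r₀
  ne_one : r₂ ≠ 1
  fix₁ : r₁ p = p
  fix₂ : r₂ p = p
  move : r₁ (r₀ p) ≠ r₀ p
  reaches : Reaches ![r₀, r₁, r₂] p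
  isThreeCycle : T.IsThreeCycle
  fix_T : T p = p
  exists_pow : ∃ k : ℕ, ((r₂ * r₁) ^ 2) ^ k = T
  overlaps : ∀ i, Overlaps T (![r₀, r₁, r₂] i)

theorem IsExtensibleTriple.attachPath {p : α} {r₀ r₁ r₂ T : Perm α}
    (h : IsExtensibleTriple p r₀ r₁ r₂ T) :
    IsExtensibleTriple (Sum.inr 3 : α ⊕ Fin 4) (extendFour r₀ * pathOdd)
      (extendFour r₁ * pathEven p) (extendFour r₂) (extendFour T) := by
  have c₀ := commute_pathOdd r₀
  have c₁ := commute_pathEven h.fix₁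
  have c₂ := commute_pathEven h.fix₂
  constructor
  case sign₀ => rw [Perm.sign_mul, sign_extendFour, h.sign₀, sign_pathOdd, one_mul]
  case sign₁ => rw [Perm.sign_mul, sign_extendFour, h.sign₁, sign_pathEven, one_mul]
  case sign₂ => rw [sign_extendFour, h.sign₂]
  case sq₀ => rw [c₀.symm.mul_mul_mul_comm, ← map_mul, h.sq₀, map_one, pathOdd_mul_self, one_mul]
  case sq₁ => rw [c₁.symm.mul_mul_mul_comm, ← map_mul, h.sq₁, map_one, pathEven_mul_self, one_mul]
  case sq₂ => rw [← map_mul, h.sq₂, map_one]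
  case comm =>
    rw [mul_assoc, ← (commute_pathOdd r₂).eq, ← mul_assoc, ← map_mul, h.comm, map_mul, mul_assoc]
  case ne_one => exact (map_ne_one_iff _ extendFour_injective).2 h.ne_one
  case fix₁ => rw [Perm.mul_apply, pathEven_three, extendFour_inr]
  case fix₂ => rw [extendFour_inr]
  case move =>
    rw [Perm.mul_apply, Perm.mul_apply, pathOdd_three, extendFour_inr, pathEven_two,
      extendFour_inr]
    simp
  case reaches =>
    refine h.reaches.attachPath (i := 1) (j := 0) h.fix₁ rfl rfl fun k => ?_
    fin_cases k <;> simp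
  case isThreeCycle => exact isThreeCycle_extendFour h.isThreeCycle
  case fix_T => rw [extendFour_inr]
  case exists_pow =>
    obtain ⟨k, hk⟩ := h.exists_pow
    refine ⟨k, ?_⟩
    rw [← hk, ← mul_assoc, (c₂.mul_left c₁).mul_pow, sq (pathEven p), pathEven_mul_self, mul_one]
    simp only [map_pow, map_mul]
  case overlaps =>
    have hTp {y : α} (hy : T y ≠ y) : y ≠ p := fun e => hy (e ▸ h.fix_T)
    intro i
    fin_cases i
    · exact (h.overlaps 0).extendFour fun y _ => by simp [pathOdd_inl]
    · exact (h.overlaps 1).extendFour fun y hy => by simp [pathEven_inl (hTp hy)]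
    · exact (h.overlaps 2).extendFour fun y _ => by simp

/-- Generation by three involutions, two of which commute; the further conditions exclude
degenerate cases. -/
def IsTripleGenerated (G : Type*) [Group G] : Prop :=
  ∃ r₀ r₁ r₂ : G, r₀ * r₀ = 1 ∧ r₁ * r₁ = 1 ∧ r₂ * r₂ = 1 ∧ r₀ * r₂ = r₂ * r₀ ∧ r₂ ≠ 1 ∧
    (r₀ * r₁) ^ 2 ≠ 1 ∧ Subgroup.closure {r₀, r₁, r₂} = ⊤

theorem closure_pair_eq_top {G : Type*} [Group G] {a b : G}
    (h : Subgroup.closure (Set.range ![a, b]) = ⊤) : Subgroup.closure {a, b} = ⊤ := by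
  rwa [Matrix.range_cons_cons_empty] at h

theorem closure_triple_eq_top {G : Type*} [Group G] {a b c : G}
    (h : Subgroup.closure (Set.range ![a, b, c]) = ⊤) : Subgroup.closure {a, b, c} = ⊤ := by
  rwa [Matrix.range_cons, Matrix.range_cons_cons_empty, Set.singleton_union] at h

theorem IsExtensibleTriple.isTripleGenerated {p : α} {r₀ r₁ r₂ T : Perm α}
    (h : IsExtensibleTriple p r₀ r₁ r₂ T) : IsTripleGenerated (alternatingGroup α) := by
  let a₀ : alternatingGroup α := ⟨r₀, h.sign₀⟩
  let a₁ : alternatingGroup α := ⟨r₁, h.sign₁⟩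
  let a₂ : alternatingGroup α := ⟨r₂, h.sign₂⟩
  refine ⟨a₀, a₁, a₂, Subtype.ext h.sq₀, Subtype.ext h.sq₁, Subtype.ext h.sq₂,
    Subtype.ext h.comm, fun e => h.ne_one (congrArg Subtype.val e), fun e => h.move ?_,
    closure_triple_eq_top ?_⟩
  · have e' : r₀ (r₁ (r₀ (r₁ p))) = p := DFunLike.congr_fun (congrArg Subtype.val e) p
    rw [h.fix₁] at e'
    calc r₁ (r₀ p) = r₀ (r₀ (r₁ (r₀ p))) := by rw [← Perm.mul_apply r₀, h.sq₀, Perm.one_apply]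
      _ = r₀ p := by rw [e']
  · obtain ⟨k, hk⟩ := h.exists_pow
    have mem (i) : ![r₀, r₁, r₂] i ∈ Subgroup.closure (Set.range ![r₀, r₁, r₂]) :=
      Subgroup.subset_closure ⟨i, rfl⟩
    refine closure_range_eq_top (fun i => ?_) h.reaches h.isThreeCycle
      (hk ▸ pow_mem (pow_mem (mul_mem (mem 2) (mem 1)) 2) k) h.overlaps
    fin_cases i <;> rfl

theorem isExtensibleTriple_of_rank {p : α} {r₀ r₁ r₂ T : Perm α} (rk : α → ℕ) (k : ℕ)
    (hs : sign r₀ = 1 ∧ sign r₁ = 1 ∧ sign r₂ = 1)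
    (h : r₀ * r₀ = 1 ∧ r₁ * r₁ = 1 ∧ r₂ * r₂ = 1 ∧ r₀ * r₂ = r₂ * r₀ ∧ r₂ ≠ 1 ∧ r₁ p = p ∧
      r₂ p = p ∧ r₁ (r₀ p) ≠ r₀ p ∧ (∀ y, y = p ∨ ∃ i, rk ((![r₀, r₁, r₂] i)⁻¹ y) < rk y) ∧
      T.support.card = 3 ∧ T p = p ∧ ((r₂ * r₁) ^ 2) ^ k = T ∧
      ∀ i, Overlaps T (![r₀, r₁, r₂] i)) : IsExtensibleTriple p r₀ r₁ r₂ T := by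
  obtain ⟨sq₀, sq₁, sq₂, comm, ne_one, fix₁, fix₂, move, hrk, hT, fix_T, hk, overlaps⟩ := h
  exact ⟨hs.1, hs.2.1, hs.2.2, sq₀, sq₁, sq₂, comm, ne_one, fix₁, fix₂, move,
    reaches_of_rank rk hrk, card_support_eq_three_iff.1 hT, fix_T, ⟨k, hk⟩, overlaps⟩

theorem isExtensibleTriple_fin_ten :
    IsExtensibleTriple (9 : Fin 10) (swap 0 6 * swap 1 4 * swap 5 9 * swap 7 8)
      (swap 1 5 * swap 2 4 * swap 3 7 * swap 6 8) (swap 0 6 * swap 2 3) (swap 0 6 * swap 6 8) :=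
  isExtensibleTriple_of_rank ![9, 2, 4, 5, 3, 1, 8, 6, 7, 0] 2
    (by simp [Perm.sign_mul, sign_swap']) (by decide +kernel)

theorem isExtensibleTriple_fin_eleven :
    IsExtensibleTriple (10 : Fin 11) (swap 1 5 * swap 2 10 * swap 6 7 * swap 8 9)
      (swap 0 8 * swap 1 3 * swap 2 9 * swap 4 6) (swap 0 4 * swap 1 7 * swap 5 6 * swap 8 9)
      (swap 1 7 * swap 7 3) :=
  isExtensibleTriple_of_rank ![4, 8, 1, 9, 5, 7, 6, 7, 3, 2, 0] 7
    (by simp [Perm.sign_mul, sign_swap']) (by decide +kernel)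

theorem isExtensibleTriple_fin_twelve :
    IsExtensibleTriple (11 : Fin 12) (swap 1 8 * swap 2 10 * swap 4 11 * swap 6 9)
      (swap 0 6 * swap 1 3 * swap 4 10 * swap 8 9) (swap 0 5 * swap 1 2 * swap 3 7 * swap 8 10)
      (swap 0 6 * swap 6 5) :=
  isExtensibleTriple_of_rank ![6, 4, 3, 5, 1, 7, 5, 6, 3, 4, 2, 0] 2
    (by simp [Perm.sign_mul, sign_swap']) (by decide +kernel)

theorem isExtensibleTriple_fin_thirteen :
    IsExtensibleTriple (12 : Fin 13)
      (swap 0 9 * swap 1 10 * swap 2 5 * swap 3 4 * swap 6 8 * swap 7 12)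
      (swap 0 3 * swap 2 4 * swap 7 8 * swap 9 11) (swap 0 1 * swap 3 6 * swap 4 8 * swap 9 10)
      (swap 9 11 * swap 11 10) :=
  isExtensibleTriple_of_rank ![5, 6, 4, 4, 3, 5, 3, 1, 2, 6, 7, 7, 0] 2
    (by simp [Perm.sign_mul, sign_swap']) (by decide +kernel)

end Triples

section ChiralPairs

/-- The word `D` is a relation between `x` and `y` but not between their inverses, which certifies
that no automorphism inverts both. -/
def IsChiralRelation {G : Type*} [Group G] (x y : G) (D : FreeGroup (Fin 2)) : Prop :=
  FreeGroup.lift ![x, y] D = 1 ∧ FreeGroup.lift ![x⁻¹, y⁻¹] D ≠ 1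

theorem map_freeGroup_lift_pair {G H : Type*} [Group G] [Group H] (f : G →* H) (x y : G)
    (D : FreeGroup (Fin 2)) : f (FreeGroup.lift ![x, y] D) = FreeGroup.lift ![f x, f y] D := by
  have : f.comp (FreeGroup.lift ![x, y]) = FreeGroup.lift ![f x, f y] := by
    ext i
    fin_cases i <;> simp
  exact DFunLike.congr_fun this D

theorem isChiralRelation_map_iff {G H : Type*} [Group G] [Group H] {f : G →* H}
    (hf : Function.Injective f) {x y : G} {D : FreeGroup (Fin 2)} :
    IsChiralRelation (f x) (f y) D ↔ IsChiralRelation x y D := by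
  rw [IsChiralRelation, ← map_inv, ← map_inv, ← map_freeGroup_lift_pair,
    ← map_freeGroup_lift_pair, map_ne_one_iff f hf, map_eq_one_iff f hf, IsChiralRelation]

theorem IsChiralRelation.not_isReflexible {G : Type*} [Group G] {x y : G} {D : FreeGroup (Fin 2)}
    (h : IsChiralRelation x y D) : ¬ IsReflexible x y := by
  rintro ⟨φ, hx, hy⟩
  refine h.2 ?_
  rw [← hx, ← hy]
  exact (map_freeGroup_lift_pair φ.toMonoidHom x y D).symm.trans
    ((congrArg φ h.1).trans (map_one φ))

theorem IsReflexible.sq_conj_sq {G : Type*} [Group G] {s z : G} (h : IsReflexible s z) :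
    IsReflexible (z * z) (s * (z * z) * s) := by
  obtain ⟨φ, hs, hz⟩ := h
  exact ⟨φ, by simp only [map_mul, hz, mul_inv_rev], by simp only [map_mul, hs, hz, mul_inv_rev,
    mul_assoc]⟩

variable {α : Type*} [Fintype α] [DecidableEq α] {p : α} {s z T : Perm α}

/-- An even involution `s` and an even permutation `z` which generate the alternating group, are
not simultaneously inverted by an automorphism, and to which a path can be attached at `p`. The
3-cycle `T` and the asymmetric relation involve only `z²` and `s z² s`, since attaching the path
does not change the action of these elements on the old points. -/
structure IsExtensibleChiralPair (p : α) (s z T : Perm α) : Prop where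
  sign_s : sign s = 1
  sign_z : sign z = 1
  sq_s : s * s = 1
  fix_z : z p = p
  move_s : s p ≠ p
  reaches : Reaches ![s, z] p
  isThreeCycle : T.IsThreeCycle
  fix_T : T p = p
  mem_closure : T ∈ Subgroup.closure (Set.range ![z * z, s * (z * z) * s])
  overlaps : ∀ i, Overlaps T (![s, z] i)
  exists_isChiralRelation : ∃ D, IsChiralRelation (z * z) (s * (z * z) * s) D

theorem IsExtensibleChiralPair.attachPath (h : IsExtensibleChiralPair p s z T) :
    IsExtensibleChiralPair (Sum.inr 3 : α ⊕ Fin 4) (extendFour s * pathOdd)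
      (extendFour z * pathEven p) (extendFour T) := by
  have cs := commute_pathOdd s
  have cz := commute_pathEven h.fix_z
  have sq_z : extendFour z * pathEven p * (extendFour z * pathEven p) = extendFour (z * z) := by
    rw [cz.symm.mul_mul_mul_comm, ← map_mul, pathEven_mul_self, mul_one]
  have conj_sq_z : extendFour s * pathOdd * extendFour (z * z) * (extendFour s * pathOdd) =
      extendFour (s * (z * z) * s) := by
    rw [mul_conj_of_commute cs (commute_pathOdd (z * z)) pathOdd_mul_self, ← map_mul, ← map_mul]
  constructor
  case sign_s => rw [Perm.sign_mul, sign_extendFour, h.sign_s, sign_pathOdd, one_mul]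
  case sign_z => rw [Perm.sign_mul, sign_extendFour, h.sign_z, sign_pathEven, one_mul]
  case sq_s => rw [cs.symm.mul_mul_mul_comm, ← map_mul, h.sq_s, map_one, pathOdd_mul_self, one_mul]
  case fix_z => rw [Perm.mul_apply, pathEven_three, extendFour_inr]
  case move_s =>
    rw [Perm.mul_apply, pathOdd_three, extendFour_inr]
    simp
  case reaches =>
    refine h.reaches.attachPath (i := 1) (j := 0) h.fix_z rfl rfl fun k => ?_
    fin_cases k <;> simp
  case isThreeCycle => exact isThreeCycle_extendFour h.isThreeCycle
  case fix_T => rw [extendFour_inr]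
  case mem_closure =>
    have := Subgroup.mem_map_of_mem extendFour h.mem_closure
    rwa [MonoidHom.map_closure, Matrix.range_cons_cons_empty, Set.image_pair,
      ← Matrix.range_cons_cons_empty, ← conj_sq_z, ← sq_z] at this
  case overlaps =>
    have hTp {y : α} (hy : T y ≠ y) : y ≠ p := fun e => hy (e ▸ h.fix_T)
    intro i
    fin_cases i
    · exact (h.overlaps 0).extendFour fun y _ => by simp [pathOdd_inl]
    · exact (h.overlaps 1).extendFour fun y hy => by simp [pathEven_inl (hTp hy)]
  case exists_isChiralRelation =>
    obtain ⟨D, hD⟩ := h.exists_isChiralRelation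
    refine ⟨D, ?_⟩
    rw [sq_z, conj_sq_z]
    exact (isChiralRelation_map_iff extendFour_injective).2 hD

/-- Generation by an involution and another element which are not simultaneously inverted by an
automorphism. -/
def IsChirallyGenerated (G : Type*) [Group G] : Prop :=
  ∃ s z : G, s * s = 1 ∧ s ≠ 1 ∧ Subgroup.closure {s, z} = ⊤ ∧ ¬ IsReflexible s z

theorem IsExtensibleChiralPair.isChirallyGenerated (h : IsExtensibleChiralPair p s z T) :
    IsChirallyGenerated (alternatingGroup α) := by
  let s' : alternatingGroup α := ⟨s, h.sign_s⟩
  let z' : alternatingGroup α := ⟨z, h.sign_z⟩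
  refine ⟨s', z', Subtype.ext h.sq_s, fun e => h.move_s ?_, ?_, fun hrefl => ?_⟩
  · exact DFunLike.congr_fun (congrArg Subtype.val e : s = 1) p
  · have mem (i) : ![s, z] i ∈ Subgroup.closure (Set.range ![s, z]) :=
      Subgroup.subset_closure ⟨i, rfl⟩
    refine closure_pair_eq_top
      (closure_range_eq_top (fun i => ?_) h.reaches h.isThreeCycle ?_ h.overlaps)
    · fin_cases i <;> rfl
    · refine (Subgroup.closure_le _).2 ?_ h.mem_closure
      rintro _ ⟨i, rfl⟩
      fin_cases i
      exacts [mul_mem (mem 1) (mem 1), mul_mem (mul_mem (mem 0) (mul_mem (mem 1) (mem 1))) (mem 0)]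
  · obtain ⟨D, hD⟩ := h.exists_isChiralRelation
    exact ((isChiralRelation_map_iff (x := z' * z') (y := s' * (z' * z') * s')
      (alternatingGroup α).subtype_injective).1 hD).not_isReflexible hrefl.sq_conj_sq

theorem isExtensibleChiralPair_of_rank (rk : α → ℕ) (w : List (Fin 2 × Bool)) (m k : ℕ)
    (hs : sign s = 1 ∧ sign z = 1)
    (h : s * s = 1 ∧ z p = p ∧ s p ≠ p ∧ (∀ y, y = p ∨ ∃ i, rk ((![s, z] i)⁻¹ y) < rk y) ∧
      T.support.card = 3 ∧ T p = p ∧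
      FreeGroup.lift ![z * z, s * (z * z) * s] (FreeGroup.mk w) ^ m = T ∧
      (∀ i, Overlaps T (![s, z] i)) ∧
      FreeGroup.lift ![z * z, s * (z * z) * s]
        (FreeGroup.mk [(0, true), (0, true), (1, true), (0, true), (1, false)]) ^ k = 1 ∧
      FreeGroup.lift ![(z * z)⁻¹, (s * (z * z) * s)⁻¹]
        (FreeGroup.mk [(0, true), (0, true), (1, true), (0, true), (1, false)]) ^ k ≠ 1) :
    IsExtensibleChiralPair p s z T := by
  obtain ⟨sq_s, fix_z, move_s, hrk, hT, fix_T, hw, overlaps, hD, hD'⟩ := h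
  refine ⟨hs.1, hs.2, sq_s, fix_z, move_s, reaches_of_rank rk hrk, card_support_eq_three_iff.1 hT,
    fix_T, hw ▸ pow_mem (freeGroup_lift_mem_closure _ _) m, overlaps,
    FreeGroup.mk [(0, true), (0, true), (1, true), (0, true), (1, false)] ^ k, ?_, ?_⟩
  · rwa [map_pow]
  · rwa [map_pow]

theorem isExtensibleChiralPair_fin_eight :
    IsExtensibleChiralPair (7 : Fin 8) (swap 0 6 * swap 5 7)
      (swap 0 6 * swap 6 2 * swap 2 1 * swap 1 4 * swap 4 3 * swap 3 5) (swap 1 5 * swap 5 4) :=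
  isExtensibleChiralPair_of_rank ![2, 5, 4, 7, 6, 1, 3, 0]
    [(0, true), (0, true), (1, false)] 5 5
    (by simp [Perm.sign_mul, sign_swap']) (by decide +kernel)

theorem isExtensibleChiralPair_fin_nine :
    IsExtensibleChiralPair (8 : Fin 9) (swap 0 1 * swap 2 3 * swap 5 6 * swap 7 8)
      (swap 0 2 * swap 2 7 * swap 7 5 * swap 5 4 * swap 1 6 * swap 6 3) (swap 2 4 * swap 4 5) :=
  isExtensibleChiralPair_of_rank ![4, 5, 5, 4, 3, 2, 3, 1, 0]
    [(0, false), (1, true), (1, true), (1, true), (1, true), (1, true), (0, true)] 1 4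
    (by simp [Perm.sign_mul, sign_swap']) (by decide +kernel)

theorem isExtensibleChiralPair_fin_ten :
    IsExtensibleChiralPair (9 : Fin 10) (swap 0 1 * swap 2 4 * swap 3 6 * swap 7 9)
      (swap 0 8 * swap 8 2 * swap 2 3 * swap 3 4 * swap 1 5 * swap 6 7) (swap 2 3 * swap 3 6) :=
  isExtensibleChiralPair_of_rank ![5, 6, 5, 3, 4, 7, 2, 1, 6, 0]
    [(0, true), (0, true), (1, true), (1, true)] 2 2
    (by simp [Perm.sign_mul, sign_swap']) (by decide +kernel)

theorem isExtensibleChiralPair_fin_eleven :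
    IsExtensibleChiralPair (10 : Fin 11) (swap 0 4 * swap 2 3 * swap 5 10 * swap 6 8)
      (swap 0 6 * swap 6 7 * swap 1 2 * swap 2 4 * swap 4 5 * swap 8 9) (swap 0 6 * swap 6 7) :=
  isExtensibleChiralPair_of_rank ![5, 2, 3, 4, 4, 1, 6, 7, 7, 8, 0]
    [(0, true)] 2 4
    (by simp [Perm.sign_mul, sign_swap']) (by decide +kernel)

end ChiralPairs

/-- Generation by three non-trivial involutions `a, b, c` such that `ab` and `ac` have different
orders, so that no automorphism fixes `a` and transposes `b` and `c`. -/
def IsInvolutionGenerated (G : Type*) [Group G] : Prop :=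
  ∃ a b c : G, a * a = 1 ∧ b * b = 1 ∧ c * c = 1 ∧ a ≠ 1 ∧ b ≠ 1 ∧ c ≠ 1 ∧
    (∃ k : ℕ, (a * b) ^ k = 1 ∧ (a * c) ^ k ≠ 1) ∧ Subgroup.closure {a, b, c} = ⊤

theorem IsTripleGenerated.isInvolutionGenerated {G : Type*} [Group G] (h : IsTripleGenerated G) :
    IsInvolutionGenerated G := by
  obtain ⟨r₀, r₁, r₂, h₀, h₁, h₂, h₀₂, hr₂, h₀₁, hgen⟩ := h
  refine ⟨r₀, r₂, r₁, h₀, h₂, h₁, ?_, hr₂, ?_, ⟨2, ?_, h₀₁⟩, Set.pair_comm r₁ r₂ ▸ hgen⟩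
  · rintro rfl
    exact h₀₁ (by rw [one_mul, sq, h₁])
  · rintro rfl
    exact h₀₁ (by rw [mul_one, sq, h₀])
  · rw [(show Commute r₀ r₂ from h₀₂).mul_pow, sq, sq, h₀, h₂, one_mul]

theorem orderOf_ne_of_pow {G : Type*} [Group G] {x y : G} {k : ℕ} (hx : x ^ k = 1)
    (hy : y ^ k ≠ 1) : orderOf x ≠ orderOf y := fun h =>
  hy (orderOf_dvd_iff_pow_eq_one.1 (h ▸ orderOf_dvd_of_pow_eq_one hx))

section MulEquiv

variable {G H : Type*} [Group G] [Group H]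

theorem closure_image_eq_top (e : G ≃* H) {S : Set G} (h : Subgroup.closure S = ⊤) :
    Subgroup.closure (e '' S) = ⊤ := by
  have := MonoidHom.map_closure e.toMonoidHom S
  rw [h, Subgroup.map_top_of_surjective _ e.surjective] at this
  exact this.symm

theorem IsReflexible.of_map (e : G ≃* H) {x y : G} (h : IsReflexible (e x) (e y)) :
    IsReflexible x y := by
  obtain ⟨φ, hx, hy⟩ := h
  exact ⟨e.trans (φ.trans e.symm), by simp [hx], by simp [hy]⟩

theorem IsTripleGenerated.of_mulEquiv (e : G ≃* H) (h : IsTripleGenerated G) :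
    IsTripleGenerated H := by
  obtain ⟨r₀, r₁, r₂, h₀, h₁, h₂, h₀₂, hr₂, h₀₁, hgen⟩ := h
  refine ⟨e r₀, e r₁, e r₂, ?_, ?_, ?_, ?_, (map_ne_one_iff e e.injective).2 hr₂, ?_, ?_⟩
  · rw [← map_mul, h₀, map_one]
  · rw [← map_mul, h₁, map_one]
  · rw [← map_mul, h₂, map_one]
  · rw [← map_mul, h₀₂, map_mul]
  · rwa [← map_mul, ← map_pow, map_ne_one_iff e e.injective]
  · simpa only [Set.image_insert_eq, Set.image_singleton] using closure_image_eq_top e hgen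

theorem IsChirallyGenerated.of_mulEquiv (e : G ≃* H) (h : IsChirallyGenerated G) :
    IsChirallyGenerated H := by
  obtain ⟨s, z, hs, hs₁, hgen, hno⟩ := h
  refine ⟨e s, e z, by rw [← map_mul, hs, map_one], (map_ne_one_iff e e.injective).2 hs₁, ?_,
    fun h => hno (h.of_map e)⟩
  simpa only [Set.image_pair] using closure_image_eq_top e hgen

end MulEquiv

section Realisation

variable {G : Type} [Group G]

theorem IsTripleGenerated.isRealised_one (h : IsTripleGenerated G) : IsRealised .one G := by
  obtain ⟨r₀, r₁, r₂, h₀, h₁, h₂, h₀₂, -, -, hgen⟩ := h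
  exact isRealised_one_iff.2 ⟨r₀, r₁, r₂, h₀, h₁, h₂, h₀₂, hgen⟩

theorem IsInvolutionGenerated.isRealised_two (h : IsInvolutionGenerated G) :
    IsRealised (.two .empty) G := by
  obtain ⟨a, b, c, ha, hb, hc, -, -, -, ⟨k, hab, hac⟩, hgen⟩ := h
  refine EdgeTransitive.isRealised_two ha hb hc hgen fun ⟨φ, φ_a, φ_b, _⟩ => hac ?_
  rw [← φ_a, ← φ_b, ← map_mul, ← map_pow, hab, map_one]

theorem IsInvolutionGenerated.isRealised_three (h : IsInvolutionGenerated G) :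
    IsRealised .three G := by
  obtain ⟨a, b, c, ha, hb, hc, ha₁, hb₁, hc₁, -, hgen⟩ := h
  exact EdgeTransitive.isRealised_three ha hb hc ha₁ hb₁ hc₁ hgen

theorem IsChirallyGenerated.isRealised_twoEx (h : IsChirallyGenerated G) :
    IsRealised (.twoEx .empty) G := by
  obtain ⟨s, z, hs, -, hgen, hno⟩ := h
  exact EdgeTransitive.isRealised_twoEx hs hgen hno

theorem IsChirallyGenerated.isRealised_four (h : IsChirallyGenerated G) :
    IsRealised (.four .empty) G := by
  obtain ⟨s, z, hs, hs₁, hgen, -⟩ := h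
  exact EdgeTransitive.isRealised_four hs hs₁ hgen

theorem IsChirallyGenerated.isRealised_five (h : IsChirallyGenerated G) :
    IsRealised (.five .empty) G := by
  obtain ⟨s, z, hs, -, hgen, hno⟩ := h
  refine EdgeTransitive.isRealised_five hgen hno (orderOf_ne_of_pow (sq s ▸ hs) fun hz => ?_)
  exact hno ⟨.refl G, eq_inv_of_mul_eq_one_left hs, eq_inv_of_mul_eq_one_left (sq z ▸ hz)⟩

end Realisation

theorem exists_of_attachPath {P : ∀ (α : Type) [Fintype α] [DecidableEq α], α → Prop} {m : ℕ}
    (hP : ∀ (α : Type) [Fintype α] [DecidableEq α] (p : α), P α p → P (α ⊕ Fin 4) (Sum.inr 3))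
    (h : ∀ n, m ≤ n → n < m + 4 → ∃ p, P (Fin n) p) (n : ℕ) (hn : m ≤ n) :
    ∃ (α : Type) (_ : Fintype α) (_ : DecidableEq α) (p : α), Fintype.card α = n ∧ P α p := by
  induction n using Nat.strong_induction_on with
  | _ n ih =>
    by_cases hlt : n < m + 4
    · obtain ⟨p, hp⟩ := h n hn hlt
      exact ⟨Fin n, inferInstance, inferInstance, p, Fintype.card_fin n, hp⟩
    · obtain ⟨α, _, _, p, hc, hp⟩ := ih (n - 4) (by omega) (by omega)
      refine ⟨α ⊕ Fin 4, inferInstance, inferInstance, _, ?_, hP α p hp⟩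
      rw [Fintype.card_sum, hc, Fintype.card_fin]
      omega

theorem isTripleGenerated_alternatingGroup_five : IsTripleGenerated (alternatingGroup (Fin 5)) := by
  refine ⟨⟨swap 0 1 * swap 2 4, ?_⟩, ⟨swap 0 3 * swap 1 4, ?_⟩, ⟨swap 0 2 * swap 1 4, ?_⟩, ?_⟩
  iterate 3 simp [sign_swap']
  and_intros <;> try decide +kernel
  exact closure_triple_eq_top (closure_range_eq_top_of_word _ 0 ![0, 1, 1, 1, 2]
    (swap 0 3 * swap 3 2) [(2, true), (1, true)] 1 (by decide +kernel))

theorem isTripleGenerated_alternatingGroup_nine : IsTripleGenerated (alternatingGroup (Fin 9)) := by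
  refine ⟨⟨swap 2 3 * swap 6 7, ?_⟩, ⟨swap 1 2 * swap 3 4 * swap 5 6 * swap 7 8, ?_⟩,
    ⟨swap 0 1 * swap 4 5, ?_⟩, ?_⟩
  iterate 3 simp [sign_swap']
  and_intros <;> try decide +kernel
  exact closure_triple_eq_top (closure_range_eq_top_of_word _ 0 ![0, 1, 2, 3, 4, 5, 6, 7, 8]
    (swap 0 1 * swap 1 2) [(2, true), (1, true)] 4 (by decide +kernel))

theorem isInvolutionGenerated_alternatingGroup_six :
    IsInvolutionGenerated (alternatingGroup (Fin 6)) := by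
  refine ⟨⟨swap 0 3 * swap 1 4, ?_⟩, ⟨swap 0 1 * swap 2 4, ?_⟩, ⟨swap 0 5 * swap 2 4, ?_⟩,
    ?_, ?_, ?_, ?_, ?_, ?_, ⟨5, ?_⟩, ?_⟩
  iterate 3 simp [sign_swap']
  iterate 7 decide +kernel
  exact closure_triple_eq_top (closure_range_eq_top_of_word _ 0 ![0, 1, 3, 1, 2, 1]
    (swap 0 5 * swap 5 1) [(1, true), (2, true)] 1 (by decide +kernel))

theorem isInvolutionGenerated_alternatingGroup_seven :
    IsInvolutionGenerated (alternatingGroup (Fin 7)) := by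
  refine ⟨⟨swap 0 5 * swap 1 6, ?_⟩, ⟨swap 2 6 * swap 3 4, ?_⟩, ⟨swap 2 3 * swap 5 6, ?_⟩,
    ?_, ?_, ?_, ?_, ?_, ?_, ⟨6, ?_⟩, ?_⟩
  iterate 3 simp [sign_swap']
  iterate 7 decide +kernel
  exact closure_triple_eq_top (closure_range_eq_top_of_word _ 0 ![0, 3, 3, 4, 5, 1, 2]
    (swap 1 2 * swap 2 6) [(0, true), (1, true)] 2 (by decide +kernel))

theorem isInvolutionGenerated_alternatingGroup_eight :
    IsInvolutionGenerated (alternatingGroup (Fin 8)) := by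
  refine ⟨⟨swap 3 7 * swap 5 6, ?_⟩, ⟨swap 0 3 * swap 1 7 * swap 2 4 * swap 5 6, ?_⟩,
    ⟨swap 0 5 * swap 1 4, ?_⟩, ?_, ?_, ?_, ?_, ?_, ?_, ⟨4, ?_⟩, ?_⟩
  iterate 3 simp [sign_swap']
  iterate 7 decide +kernel
  exact closure_triple_eq_top (closure_range_eq_top_of_word _ 0 ![0, 3, 5, 1, 4, 1, 2, 2]
    (swap 0 5 * swap 5 6) [(0, true), (2, true)] 2 (by decide +kernel))

theorem isRealised_four_alternatingGroup_five :
    IsRealised (.four .empty) (alternatingGroup (Fin 5)) := by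
  refine isRealised_four (b := ⟨swap 0 2 * swap 3 4, ?_⟩) (z := ⟨swap 0 1 * swap 1 3, ?_⟩)
    ?_ ?_ ?_
  iterate 2 simp [sign_swap']
  iterate 2 decide +kernel
  exact closure_pair_eq_top (closure_range_eq_top_of_word _ 0 ![0, 1, 1, 2, 3]
    (swap 0 1 * swap 1 3) [(1, true)] 1 (by decide +kernel))

theorem closure_pair_alternatingGroup_six {s z : alternatingGroup (Fin 6)}
    (hs : (s : Perm (Fin 6)) = swap 0 2 * swap 1 3)
    (hz : (z : Perm (Fin 6)) = swap 0 5 * swap 5 2 * swap 2 3 * swap 3 4) :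
    Subgroup.closure {s, z} = ⊤ := by
  have hs' : s = ⟨swap 0 2 * swap 1 3, by simp [sign_swap']⟩ := Subtype.ext hs
  have hz' : z = ⟨swap 0 5 * swap 5 2 * swap 2 3 * swap 3 4, by simp [sign_swap']⟩ :=
    Subtype.ext hz
  subst hs' hz'
  exact closure_pair_eq_top (closure_range_eq_top_of_word _ 0 ![0, 3, 1, 2, 3, 1]
    (swap 0 4 * swap 4 5) [(0, true), (1, true), (0, true), (1, true), (1, true), (0, true),
      (1, true), (1, true), (1, true)] 1 (by decide +kernel))

theorem isRealised_four_alternatingGroup_six :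
    IsRealised (.four .empty) (alternatingGroup (Fin 6)) := by
  refine isRealised_four (b := ⟨swap 0 2 * swap 1 3, ?_⟩)
    (z := ⟨swap 0 5 * swap 5 2 * swap 2 3 * swap 3 4, ?_⟩) ?_ ?_
    (closure_pair_alternatingGroup_six rfl rfl)
  iterate 2 simp [sign_swap']
  iterate 2 decide +kernel

theorem isRealised_four_alternatingGroup_seven :
    IsRealised (.four .empty) (alternatingGroup (Fin 7)) := by
  refine isRealised_four (b := ⟨swap 0 3 * swap 1 2, ?_⟩)
    (z := ⟨swap 0 2 * swap 2 6 * swap 1 5 * swap 3 4, ?_⟩) ?_ ?_ ?_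
  iterate 2 simp [sign_swap']
  iterate 2 decide +kernel
  exact closure_pair_eq_top (closure_range_eq_top_of_word _ 0 ![0, 2, 1, 1, 2, 3, 2]
    (swap 0 6 * swap 6 2) [(1, true)] 2 (by decide +kernel))

theorem isRealised_five_alternatingGroup_seven :
    IsRealised (.five .empty) (alternatingGroup (Fin 7)) := by
  refine isRealised_five (a := ⟨swap 0 4 * swap 4 2 * swap 3 6 * swap 6 5, ?_⟩)
    (b := ⟨swap 0 6 * swap 6 2 * swap 2 5 * swap 5 1 * swap 1 4 * swap 4 3, ?_⟩) ?_ ?_ ?_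
  iterate 2 simp [sign_swap']
  · exact closure_pair_eq_top (closure_range_eq_top_of_word _ 0 ![0, 3, 2, 2, 1, 2, 1]
      (swap 1 4 * swap 4 2) [(0, true), (1, true), (0, true), (1, false)] 1 (by decide +kernel))
  · exact IsChiralRelation.not_isReflexible
      (D := .mk [(0, true), (1, true), (0, false), (1, true), (1, true),
        (0, true), (1, true), (0, false), (1, true), (1, true)])
      ⟨by decide +kernel, by decide +kernel⟩
  · exact orderOf_ne_of_pow (k := 3) (by decide +kernel) (by decide +kernel)

theorem isTripleGenerated_alternatingGroup {n : ℕ} (hn : n = 5 ∨ 9 ≤ n) :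
    IsTripleGenerated (alternatingGroup (Fin n)) := by
  rcases hn with rfl | hn
  · exact isTripleGenerated_alternatingGroup_five
  rcases hn.eq_or_lt with rfl | hn
  · exact isTripleGenerated_alternatingGroup_nine
  obtain ⟨α, _, _, p, hα, r₀, r₁, r₂, T, h⟩ := exists_of_attachPath (m := 10)
    (P := fun α _ _ p => ∃ r₀ r₁ r₂ T, IsExtensibleTriple (α := α) p r₀ r₁ r₂ T)
    (fun α _ _ p ⟨_, _, _, _, h⟩ => ⟨_, _, _, _, h.attachPath⟩)
    (fun n h₁ h₂ => by
      interval_cases n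
      exacts [⟨9, _, _, _, _, isExtensibleTriple_fin_ten⟩,
        ⟨10, _, _, _, _, isExtensibleTriple_fin_eleven⟩,
        ⟨11, _, _, _, _, isExtensibleTriple_fin_twelve⟩,
        ⟨12, _, _, _, _, isExtensibleTriple_fin_thirteen⟩]) n hn
  exact .of_mulEquiv (Fintype.equivFinOfCardEq hα).altCongrHom h.isTripleGenerated

theorem isChirallyGenerated_alternatingGroup {n : ℕ} (hn : 8 ≤ n) :
    IsChirallyGenerated (alternatingGroup (Fin n)) := by
  obtain ⟨α, _, _, p, hα, s, z, T, h⟩ := exists_of_attachPath (m := 8)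
    (P := fun α _ _ p => ∃ s z T, IsExtensibleChiralPair (α := α) p s z T)
    (fun α _ _ p ⟨_, _, _, h⟩ => ⟨_, _, _, h.attachPath⟩)
    (fun n h₁ h₂ => by
      interval_cases n
      exacts [⟨7, _, _, _, isExtensibleChiralPair_fin_eight⟩,
        ⟨8, _, _, _, isExtensibleChiralPair_fin_nine⟩,
        ⟨9, _, _, _, isExtensibleChiralPair_fin_ten⟩,
        ⟨10, _, _, _, isExtensibleChiralPair_fin_eleven⟩]) n hn
  exact .of_mulEquiv (Fintype.equivFinOfCardEq hα).altCongrHom h.isChirallyGenerated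

theorem isInvolutionGenerated_alternatingGroup {n : ℕ} (hn : 5 ≤ n) :
    IsInvolutionGenerated (alternatingGroup (Fin n)) := by
  by_cases h : n = 5 ∨ 9 ≤ n
  · exact (isTripleGenerated_alternatingGroup h).isInvolutionGenerated
  · have : n = 6 ∨ n = 7 ∨ n = 8 := by omega
    rcases this with rfl | rfl | rfl
    exacts [isInvolutionGenerated_alternatingGroup_six,
      isInvolutionGenerated_alternatingGroup_seven, isInvolutionGenerated_alternatingGroup_eight]

theorem isRealised_four_alternatingGroup {n : ℕ} (hn : 5 ≤ n) :
    IsRealised (.four .empty) (alternatingGroup (Fin n)) := by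
  by_cases h : 8 ≤ n
  · exact (isChirallyGenerated_alternatingGroup h).isRealised_four
  · interval_cases n
    exacts [isRealised_four_alternatingGroup_five, isRealised_four_alternatingGroup_six,
      isRealised_four_alternatingGroup_seven]

theorem isRealised_five_alternatingGroup {n : ℕ} (hn : 7 ≤ n) :
    IsRealised (.five .empty) (alternatingGroup (Fin n)) := by
  rcases hn.eq_or_lt with rfl | hn
  · exact isRealised_five_alternatingGroup_seven
  · exact (isChirallyGenerated_alternatingGroup hn).isRealised_five

end AlternatingGenerators

/-! ### Pairs in `SL₂` and in the alternating group of degree six -/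

section ProjectiveLine

open Equiv Equiv.Perm Matrix
open scoped Pointwise MatrixGroups LinearAlgebra.Projectivization

section SpecialLinear

theorem commutator_mul_left {R : Type*} [CommRing R] (A B : Matrix (Fin 2) (Fin 2) R) :
    (A * B - B * A) * A = A.adjugate * (A * B - B * A) := by
  rw [adjugate_fin_two]
  ext i j : 1
  fin_cases i <;> fin_cases j <;> simp [Matrix.mul_apply, Fin.sum_univ_two] <;> ring

theorem commutator_mul_right {R : Type*} [CommRing R] (A B : Matrix (Fin 2) (Fin 2) R) :
    (A * B - B * A) * B = B.adjugate * (A * B - B * A) := by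
  rw [← neg_sub, neg_mul, commutator_mul_left, ← mul_neg]

variable {K : Type*} [Field K] {A B : SL(2, K)}

/-- Conjugation by a non-singular matrix, as an automorphism of the special linear group. -/
noncomputable def conjSL (g : Matrix (Fin 2) (Fin 2) K) (hg : IsUnit g.det) :
    SL(2, K) ≃* SL(2, K) where
  toFun M := ⟨g * M * g⁻¹, by rw [det_conj ((isUnit_iff_isUnit_det g).2 hg), M.det_coe]⟩
  invFun M := ⟨g⁻¹ * M * g, by rw [det_conj' ((isUnit_iff_isUnit_det g).2 hg), M.det_coe]⟩
  left_inv M := Subtype.ext <| by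
    simp [mul_assoc, nonsing_inv_mul g hg, nonsing_inv_mul_cancel_left _ _ hg]
  right_inv M := Subtype.ext <| by
    simp [mul_assoc, mul_nonsing_inv g hg, mul_nonsing_inv_cancel_left _ _ hg]
  map_mul' M N := Subtype.ext <| by
    change g * (M.1 * N.1) * g⁻¹ = g * M.1 * g⁻¹ * (g * N.1 * g⁻¹)
    simp only [mul_assoc, nonsing_inv_mul_cancel_left _ _ hg]

theorem conjSL_eq_inv {g : Matrix (Fin 2) (Fin 2) K} (hg : IsUnit g.det)
    (h : g * A.1 = adjugate A.1 * g) : conjSL g hg A = A⁻¹ := by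
  refine Subtype.ext ?_
  change g * A.1 * g⁻¹ = _
  rw [h, mul_nonsing_inv_cancel_right _ _ hg]
  rfl

theorem isReflexible_of_det_ne_zero (h : det (A.1 * B.1 - B.1 * A.1) ≠ 0) : IsReflexible A B :=
  ⟨conjSL _ h.isUnit, conjSL_eq_inv _ (commutator_mul_left _ _),
    conjSL_eq_inv _ (commutator_mul_right _ _)⟩

theorem exists_smul_eq_of_mulVec_eq_zero {g : Matrix (Fin 2) (Fin 2) K} (hg : g ≠ 0)
    {v w : Fin 2 → K} (hv : v ≠ 0) (hgv : g *ᵥ v = 0) (hgw : g *ᵥ w = 0) : ∃ a : K, a • v = w := by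
  by_contra! hne
  let b := basisOfLinearIndependentOfCardEqFinrank ((LinearIndependent.pair_iff' hv).2 hne)
    (by simp)
  refine hg (toLin'.injective (b.ext fun i => ?_))
  fin_cases i <;> simp [b, hgv, hgw]

theorem exists_smul_eq_self_of_det_eq_zero (hAB : A * B ≠ B * A)
    (h : det (A.1 * B.1 - B.1 * A.1) = 0) : ∃ p : ℙ K (Fin 2 → K), A • p = p ∧ B • p = p := by
  have hg : A.1 * B.1 - B.1 * A.1 ≠ 0 := fun h => hAB (Subtype.ext (sub_eq_zero.1 h))
  obtain ⟨v, hv, hgv⟩ := exists_mulVec_eq_zero_iff.2 h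
  have fixes {C : SL(2, K)} (hC : (A.1 * B.1 - B.1 * A.1) * C.1 =
      adjugate C.1 * (A.1 * B.1 - B.1 * A.1)) :
      C • Projectivization.mk K v hv = Projectivization.mk K v hv := by
    rw [Projectivization.smul_mk, Projectivization.mk_eq_mk_iff']
    refine exists_smul_eq_of_mulVec_eq_zero hg hv hgv (w := C.1 *ᵥ v) ?_
    rw [mulVec_mulVec, hC, ← mulVec_mulVec, hgv, mulVec_zero]
  exact ⟨_, fixes (commutator_mul_left _ _), fixes (commutator_mul_right _ _)⟩

end SpecialLinear

section Reflexible

variable {G : Type*} [Group G] {x y : G}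

theorem isReflexible_of_mul_comm (hgen : Subgroup.closure {x, y} = ⊤) (h : x * y = y * x) :
    IsReflexible x y := by
  have := Subgroup.isMulCommutative_closure (k := {x, y}) (by
    rintro _ (rfl | rfl) _ (rfl | rfl) <;> simp [h])
  rw [hgen] at this
  have comm (a b : G) : a * b = b * a :=
    congrArg Subtype.val (this.is_comm.comm ⟨a, trivial⟩ ⟨b, trivial⟩)
  exact ⟨⟨Equiv.inv G, fun a b => by simp [comm a⁻¹]⟩, rfl, rfl⟩

theorem IsReflexible.of_lift {S : Type*} [Group S] {Γ : Subgroup (S × G)}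
    (hΓ : ∀ p ∈ Γ, p.2 = 1 ↔ p.1 ∈ Subgroup.center S) {A B : S} (hA : (A, x) ∈ Γ) (hB : (B, y) ∈ Γ)
    (hgen : Subgroup.closure {x, y} = ⊤) (h : IsReflexible A B) : IsReflexible x y := by
  obtain ⟨φ, φ_A, φ_B⟩ := h
  have lift : ∀ p ∈ Subgroup.closure (Set.range fun i => (![x, y] i, ![x⁻¹, y⁻¹] i)),
      ∃ C, (C, p.1) ∈ Γ ∧ (φ C, p.2) ∈ Γ := by
    intro p hp
    induction hp using Subgroup.closure_induction with
    | mem p hp =>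
      obtain ⟨i, rfl⟩ := hp
      fin_cases i
      · exact ⟨A, hA, φ_A ▸ Γ.inv_mem hA⟩
      · exact ⟨B, hB, φ_B ▸ Γ.inv_mem hB⟩
    | one => exact ⟨1, Γ.one_mem, (map_one φ).symm ▸ Γ.one_mem⟩
    | mul p q _ _ hp hq =>
      obtain ⟨C, hC, hC'⟩ := hp
      obtain ⟨D, hD, hD'⟩ := hq
      exact ⟨C * D, Γ.mul_mem hC hD, (map_mul φ C D).symm ▸ Γ.mul_mem hC' hD'⟩
    | inv p _ hp =>
      obtain ⟨C, hC, hC'⟩ := hp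
      exact ⟨C⁻¹, Γ.inv_mem hC, (map_inv φ C).symm ▸ Γ.inv_mem hC'⟩
  have graph (p) (hp : p ∈ Subgroup.closure (Set.range fun i => (![x, y] i, ![x⁻¹, y⁻¹] i))) :
      p.1 = 1 ↔ p.2 = 1 := by
    obtain ⟨C, hC, hC'⟩ := lift p hp
    exact (hΓ _ hC).trans ((MulEquivClass.apply_mem_center_iff φ).symm.trans (hΓ _ hC').symm)
  obtain ⟨α, hα⟩ := exists_mulEquiv_of_mem_closure (by rwa [Matrix.range_cons_cons_empty])
    (by rw [Matrix.range_cons_cons_empty, closure_inv_pair_eq_top hgen]) graph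
  exact ⟨α, hα 0, hα 1⟩

end Reflexible

section FieldNine

/-- The field with nine elements, as the field of Gaussian integers modulo `3`. -/
abbrev FieldNine : Type := QuadraticAlgebra (ZMod 3) 2 0

instance : Fact (∀ r : ZMod 3, r ^ 2 ≠ 2 + 0 * r) := ⟨by decide⟩

instance : Fintype FieldNine := Fintype.ofEquiv _ (QuadraticAlgebra.equivProd 2 0).symm

/-- The three-element subsets of a set of six elements, each of which stands for the bisection of
this set into itself and its complement. -/
abbrev halves : Finset (Finset (Fin 6)) := Finset.powersetCard 3 Finset.univ

/-- Homogeneous coordinates for a bijection between the ten bisections of a set of six elements and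
the projective line over the field with nine elements. A bisection is represented by that half whose
characteristic function is the smaller binary number. -/
def bisectionLabel (X : Finset (Fin 6)) : Fin 2 → FieldNine :=
  match min (∑ i ∈ X, 2 ^ i.val) (63 - ∑ i ∈ X, 2 ^ i.val) with
  | 7 => ![1, ⟨2, 2⟩]
  | 11 => ![1, ⟨1, 1⟩]
  | 13 => ![1, ⟨2, 1⟩]
  | 14 => ![1, ⟨1, 2⟩]
  | 19 => ![1, 0]
  | 21 => ![1, ⟨0, 2⟩]
  | 22 => ![1, ⟨2, 0⟩]
  | 25 => ![1, 1]
  | 26 => ![1, ⟨0, 1⟩]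
  | _ => ![0, 1]

theorem bisectionLabel_ne_zero : ∀ X, bisectionLabel X ≠ 0 := by
  decide +kernel

theorem eq_or_eq_compl_of_smul_bisectionLabel_eq : ∀ X ∈ halves, ∀ Y ∈ halves,
    (∃ a : FieldNine, a • bisectionLabel Y = bisectionLabel X) → Y = X ∨ Y = Xᶜ := by
  decide +kernel

theorem exists_smul_bisectionLabel_eq :
    ∀ v : Fin 2 → FieldNine, ∃ X ∈ halves, ∃ a : FieldNine, a • bisectionLabel X = v := by
  decide +kernel

theorem eq_one_of_forall_smul_eq_or_eq_compl : ∀ u : Perm (Fin 6),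
    (∀ X ∈ halves, u • X = X ∨ u • X = Xᶜ) → u = 1 := by
  decide +kernel

/-- The point of the projective line over the field with nine elements which corresponds to the
bisection into `X` and its complement. -/
def bisectionPoint (X : Finset (Fin 6)) : ℙ FieldNine (Fin 2 → FieldNine) :=
  .mk _ (bisectionLabel X) (bisectionLabel_ne_zero X)

theorem eq_or_eq_compl_of_bisectionPoint_eq {X Y : Finset (Fin 6)} (hX : X ∈ halves)
    (hY : Y ∈ halves) (h : bisectionPoint Y = bisectionPoint X) : Y = X ∨ Y = Xᶜ :=
  eq_or_eq_compl_of_smul_bisectionLabel_eq X hX Y hY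
    ((Projectivization.mk_eq_mk_iff' ..).1 h.symm)

theorem exists_bisectionPoint_eq (p : ℙ FieldNine (Fin 2 → FieldNine)) :
    ∃ X ∈ halves, bisectionPoint X = p := by
  induction p using Projectivization.ind with | _ v hv =>
  obtain ⟨X, hX, a, rfl⟩ := exists_smul_bisectionLabel_eq v
  exact ⟨X, hX, ((Projectivization.mk_eq_mk_iff' ..).2 ⟨a, rfl⟩).symm⟩

theorem smul_mem_halves (u : Perm (Fin 6)) {X : Finset (Fin 6)} (hX : X ∈ halves) :
    u • X ∈ halves := by
  rw [Finset.mem_powersetCard_univ] at hX ⊢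
  rw [Finset.card_smul_finset, hX]

/-- The pairs of a matrix of determinant `1` and a permutation of six elements which correspond to
the same permutation of the projective line and of the bisections. This subgroup is the preimage of
the graph of the exceptional isomorphism `PSL₂(9) ≅ A₆`. -/
def exceptionalLift : Subgroup (SL(2, FieldNine) × Perm (Fin 6)) where
  carrier := {p | ∀ X ∈ halves, p.1 • bisectionPoint X = bisectionPoint (p.2 • X)}
  one_mem' X _ := by simp only [Prod.fst_one, Prod.snd_one, one_smul]
  mul_mem' {p q} hp hq X hX := by
    rw [Prod.fst_mul, Prod.snd_mul, mul_smul, mul_smul, hq X hX, hp _ (smul_mem_halves _ hX)]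
  inv_mem' {p} hp X hX := by
    rw [Prod.fst_inv, Prod.snd_inv, inv_smul_eq_iff, hp _ (smul_mem_halves _ hX), smul_inv_smul]

theorem eq_one_iff_mem_center {p : SL(2, FieldNine) × Perm (Fin 6)} (hp : p ∈ exceptionalLift) :
    p.2 = 1 ↔ p.1 ∈ Subgroup.center SL(2, FieldNine) := by
  rw [← Projectivization.SL_mulAction_ker, MonoidHom.mem_ker]
  constructor
  · refine fun h => Equiv.ext fun q => ?_
    obtain ⟨X, hX, rfl⟩ := exists_bisectionPoint_eq q
    exact (hp X hX).trans (by rw [h, one_smul, Perm.one_apply])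
  · refine fun h => eq_one_of_forall_smul_eq_or_eq_compl _ fun X hX =>
      eq_or_eq_compl_of_bisectionPoint_eq hX (smul_mem_halves _ hX) ((hp X hX).symm.trans ?_)
    exact DFunLike.congr_fun h (bisectionPoint X)

theorem mk_mem_exceptionalLift {A : SL(2, FieldNine)} {u : Perm (Fin 6)} (h : ∀ X ∈ halves,
    ∃ a : FieldNine, a • bisectionLabel (u • X) = A.1 *ᵥ bisectionLabel X) :
    (A, u) ∈ exceptionalLift := fun X hX => by
  rw [bisectionPoint, Projectivization.smul_mk]
  exact (Projectivization.mk_eq_mk_iff' ..).2 (h X hX)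

theorem exists_mem_exceptionalLift (u : alternatingGroup (Fin 6)) :
    ∃ A, (A, (u : Perm (Fin 6))) ∈ exceptionalLift := by
  let s : alternatingGroup (Fin 6) := ⟨swap 0 2 * swap 1 3, by simp [sign_swap']⟩
  let z : alternatingGroup (Fin 6) :=
    ⟨swap 0 5 * swap 5 2 * swap 2 3 * swap 3 4, by simp [sign_swap']⟩
  suffices Subgroup.closure {s, z} ≤ (exceptionalLift.map (MonoidHom.snd _ _)).comap
      (alternatingGroup (Fin 6)).subtype by
    obtain ⟨⟨A, _⟩, hA, rfl⟩ := this (closure_pair_alternatingGroup_six (s := s) (z := z) rfl rfl ▸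
      Subgroup.mem_top u)
    exact ⟨A, hA⟩
  rw [Subgroup.closure_le]
  rintro _ (rfl | rfl)
  · exact ⟨(⟨!![0, 1; 2, 0], by decide +kernel⟩, s),
      mk_mem_exceptionalLift (by decide +kernel), rfl⟩
  · exact ⟨(⟨!![0, ⟨1, 1⟩; ⟨1, 2⟩, ⟨1, 1⟩], by decide +kernel⟩, z),
      mk_mem_exceptionalLift (by decide +kernel), rfl⟩

end FieldNine

section Reflexible

variable {G : Type*} [Group G] {x y : G}

theorem isReflexible_of_injective {φ : G →* alternatingGroup (Fin 6)} (hφ : Function.Injective φ)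
    {w : G} (hw : ∀ X ∈ halves, (φ w : Perm (Fin 6)) • X ≠ X ∧ (φ w : Perm (Fin 6)) • X ≠ Xᶜ)
    (hgen : Subgroup.closure {x, y} = ⊤) : IsReflexible x y := by
  let Γ : Subgroup (SL(2, FieldNine) × G) :=
    exceptionalLift.comap (.prodMap (.id _) ((alternatingGroup (Fin 6)).subtype.comp φ))
  obtain ⟨A, hA : (A, x) ∈ Γ⟩ := exists_mem_exceptionalLift (φ x)
  obtain ⟨B, hB : (B, y) ∈ Γ⟩ := exists_mem_exceptionalLift (φ y)
  have hΓ (p) (hp : p ∈ Γ) : p.2 = 1 ↔ p.1 ∈ Subgroup.center SL(2, FieldNine) := by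
    rw [← map_eq_one_iff φ hφ, Subtype.ext_iff]
    exact eq_one_iff_mem_center hp
  by_cases hAB : A * B = B * A
  · refine isReflexible_of_mul_comm hgen (div_eq_one.1 ?_)
    refine (hΓ _ (Γ.div_mem (Γ.mul_mem hA hB) (Γ.mul_mem hB hA))).2 ?_
    change A * B / (B * A) ∈ _
    rw [hAB, div_self']
    exact Subgroup.one_mem _
  by_cases hdet : det (A.1 * B.1 - B.1 * A.1) = 0
  · obtain ⟨p, hAp, hBp⟩ := exists_smul_eq_self_of_det_eq_zero hAB hdet
    obtain ⟨X, hX, rfl⟩ := exists_bisectionPoint_eq p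
    have h : Subgroup.closure {x, y} ≤
        (Γ ⊓ (MulAction.stabilizer _ (bisectionPoint X)).prod ⊤).map (MonoidHom.snd _ _) := by
      rw [Subgroup.closure_le]
      rintro _ (rfl | rfl)
      exacts [⟨_, ⟨hA, hAp, trivial⟩, rfl⟩, ⟨_, ⟨hB, hBp, trivial⟩, rfl⟩]
    obtain ⟨⟨C, _⟩, ⟨hC, hCp, -⟩, rfl⟩ := h (hgen ▸ Subgroup.mem_top w)
    have := eq_or_eq_compl_of_bisectionPoint_eq hX (smul_mem_halves _ hX)
      ((hC X hX).symm.trans hCp)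
    exact (this.elim (hw X hX).1 (hw X hX).2).elim
  · exact .of_lift hΓ hA hB hgen (isReflexible_of_det_ne_zero hdet)

theorem isReflexible_alternatingGroup_six {x y : alternatingGroup (Fin 6)}
    (hgen : Subgroup.closure {x, y} = ⊤) : IsReflexible x y :=
  isReflexible_of_injective (φ := .id _) Function.injective_id
    (w := ⟨swap 0 1 * swap 1 2 * swap 2 3 * swap 3 4, by simp [sign_swap']⟩)
    (by decide +kernel) hgen

theorem isReflexible_alternatingGroup_five {x y : alternatingGroup (Fin 5)}
    (hgen : Subgroup.closure {x, y} = ⊤) : IsReflexible x y := by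
  let e := extendDomainHom (finSuccAboveEquiv (Fin.last 5))
  let φ : alternatingGroup (Fin 5) →* alternatingGroup (Fin 6) :=
    (e.comp (alternatingGroup (Fin 5)).subtype).codRestrict _ fun u =>
      (sign_extendDomain u.1 _).trans u.2
  refine isReflexible_of_injective (φ := φ) ?_
    (w := ⟨swap 0 1 * swap 1 2 * swap 2 3 * swap 3 4, by simp [sign_swap']⟩)
    (by decide +kernel) hgen
  exact fun u v h => Subtype.ext (extendDomainHom_injective _ (congrArg Subtype.val h))

end Reflexible

end ProjectiveLine

/-! ### Searches in degrees six to eight -/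

section SmallDegrees

open Equiv Equiv.Perm
open scoped Pointwise

section Codes

variable {n : ℕ}

/-- The list of values of a permutation of `Fin n`; the finite searches below run on these lists,
which the kernel handles much faster than permutations. -/
def code (g : Perm (Fin n)) : List ℕ := List.ofFn fun i => (g i : ℕ)

/-- The code of a product of permutations in terms of their codes. -/
def codeMul (l l' : List ℕ) : List ℕ := l'.map fun i => l.getD i 0

/-- The codes of the permutations of `Fin n` of sign `ε` which fix all points `≥ k`. A permutation
moving `k` arises as `g * swap k b` from one which fixes `k`, with `b < k`; only those `b` are used
which `ok` admits in view of the code of `g`. -/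
def signedCodes (n : ℕ) (ok : List ℕ → ℕ → Bool) : ℕ → ℤˣ → List (List ℕ)
  | 0, ε => if ε = 1 then [List.range n] else []
  | k + 1, ε => signedCodes n ok k ε ++ (signedCodes n ok k (-ε)).flatMap fun l =>
      ((List.range k).filter (ok l)).map fun b => (l.set k (l.getD b 0)).set b k

/-- The codes of all even permutations of `Fin n`. -/
def evenCodes (n : ℕ) : List (List ℕ) := signedCodes n (fun _ _ => true) n 1

/-- The codes of the even permutations of `Fin n` whose square is trivial. -/
def evenInvolutionCodes (n : ℕ) : List (List ℕ) :=
  signedCodes n (fun l b => Nat.beq (l.getD b 0) b) n 1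

theorem getD_code (g : Perm (Fin n)) (i : Fin n) : (code g).getD i 0 = g i := by
  simp [code]

theorem code_injective : Function.Injective (code (n := n)) := fun g h e =>
  Equiv.ext fun i => Fin.ext <| by rw [← getD_code g, e, getD_code]

theorem codeMul_code (g h : Perm (Fin n)) : codeMul (code g) (code h) = code (g * h) := by
  simp only [codeMul, code, List.map_ofFn]
  exact congrArg _ (funext fun i => getD_code g (h i))

theorem code_one : code (1 : Perm (Fin n)) = List.range n := by
  simp only [code, Perm.one_apply, List.ofFn_eq_map, List.map_coe_finRange_eq_range]

theorem code_mul_swap (g : Perm (Fin n)) (a b : Fin n) :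
    code (g * swap a b) = ((code g).set a (g b)).set b (g a) := by
  refine List.ext_getElem (by simp [code]) fun i hi _ => ?_
  simp only [code, List.getElem_ofFn, List.getElem_set, Perm.mul_apply, swap_apply_def]
  grind

theorem code_mem_signedCodes {ok : List ℕ → ℕ → Bool} {P : Perm (Fin n) → Prop}
    (hP : ∀ g a b, P g → g b = a → b < a →
      P (g * swap a b) ∧ ok (code (g * swap a b)) b)
    {k : ℕ} (hk : k ≤ n) {g : Perm (Fin n)} (hg : P g) (hfix : ∀ i : Fin n, k ≤ i → g i = i) :
    code g ∈ signedCodes n ok k (sign g) := by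
  induction k generalizing g with
  | zero =>
    obtain rfl : g = 1 := Equiv.ext fun i => hfix i i.val.zero_le
    simp [signedCodes, code_one]
  | succ k ih =>
    let a : Fin n := ⟨k, hk⟩
    rw [signedCodes, List.mem_append]
    by_cases ha : g a = a
    · refine .inl (ih (by omega) hg fun i hi => ?_)
      rcases hi.eq_or_lt with rfl | hi
      exacts [ha, hfix i hi]
    have hb : g (g⁻¹ a) = a := g.apply_symm_apply a
    generalize g⁻¹ a = b at hb
    have hba : b < a := by
      by_contra! h
      rcases h.eq_or_lt with rfl | h
      · exact ha hb
      · exact h.ne' ((hfix b h).symm.trans hb)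
    obtain ⟨hP', hok⟩ := hP g a b hg hb hba
    have hmem := ih (g := g * swap a b) (by omega) hP' fun i hi => by
      rcases eq_or_ne i a with rfl | hia
      · simp [hb]
      · have hlt : a < i := lt_of_le_of_ne hi hia.symm
        rw [Perm.mul_apply, swap_apply_of_ne_of_ne hia (hba.trans hlt).ne', hfix i hlt]
    rw [Perm.sign_mul, sign_swap hba.ne', mul_neg_one] at hmem
    refine .inr (List.mem_flatMap.2 ⟨_, hmem, List.mem_map.2 ⟨b, ?_, ?_⟩⟩)
    · exact List.mem_filter.2 ⟨List.mem_range.2 hba, hok⟩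
    · have h := code_mul_swap (g * swap a b) a b
      rw [mul_assoc, swap_mul_self, mul_one, Perm.mul_apply, Perm.mul_apply, swap_apply_right,
        swap_apply_left, hb] at h
      rw [getD_code, Perm.mul_apply, swap_apply_right]
      exact h.symm

theorem code_mem_evenCodes {g : Perm (Fin n)} (hs : sign g = 1) : code g ∈ evenCodes n := by
  rw [evenCodes, ← hs]
  exact code_mem_signedCodes (P := fun _ => True) (fun _ _ _ _ _ _ => ⟨trivial, rfl⟩) le_rfl
    trivial fun i hi => absurd i.2 hi.not_gt

theorem code_mem_evenInvolutionCodes {g : Perm (Fin n)} (hg : g * g = 1) (hs : sign g = 1) :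
    code g ∈ evenInvolutionCodes n := by
  rw [evenInvolutionCodes, ← hs]
  refine code_mem_signedCodes (P := fun g => g * g = 1) (fun g a b hg hb _ => ?_) le_rfl hg
    fun i hi => absurd i.2 hi.not_gt
  have ha : g a = b := by rw [← hb, ← Perm.mul_apply, hg, Perm.one_apply]
  constructor
  · nth_rw 1 [mul_swap_eq_swap_mul]
    rw [ha, hb, mul_assoc, ← mul_assoc g, hg, one_mul, swap_comm, swap_mul_self]
  · rw [getD_code, Perm.mul_apply, swap_apply_right, ha, Nat.beq_refl]

end Codes

section SetFamilies

variable {n : ℕ}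

/-- Whether the permutation with code `l` maps the set with the binary digits of `S` to the set with
the binary digits of `T`. -/
def mapsSet : List ℕ → ℕ → ℕ → Bool
  | [], _, _ => true
  | v :: l, T, S => (T.testBit v == S.testBit 0) && mapsSet l T (S >>> 1)

/-- Whether the permutation with code `l` preserves a family of sets, encoded by binary digits. -/
def preservesFamily (o : List ℕ) (l : List ℕ) : Bool := o.all fun S => o.any fun T => mapsSet l T S

/-- The subset of `Fin n` with the binary digits of `S` as its characteristic function. -/
def bitSet (n S : ℕ) : Finset (Fin n) := {i | S.testBit i}

/-- The family of the sets encoded by the elements of a list. -/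
def setFamily (n : ℕ) (o : List ℕ) : Finset (Finset (Fin n)) := (o.map (bitSet n)).toFinset

theorem mapsSet_ofFn {m : ℕ} (f : Fin m → ℕ) (T S : ℕ) :
    mapsSet (List.ofFn f) T S ↔ ∀ i, T.testBit (f i) = S.testBit i := by
  induction m generalizing S with
  | zero => simp [mapsSet]
  | succ m ih => simp [mapsSet, ih, Fin.forall_fin_succ, Nat.testBit_shiftRight, add_comm]

theorem mapsSet_code {g : Perm (Fin n)} {T S : ℕ} :
    mapsSet (code g) T S ↔ bitSet n T = g • bitSet n S := by
  rw [code, mapsSet_ofFn, Finset.ext_iff,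
    ← g.forall_congr_right (q := fun j => j ∈ bitSet n T ↔ j ∈ g • bitSet n S)]
  refine forall_congr' fun i => ?_
  rw [← Perm.smul_def, Finset.smul_mem_smul_finset_iff, Bool.eq_iff_iff]
  simp [bitSet]

theorem preservesFamily_code {o : List ℕ} {g : Perm (Fin n)} :
    preservesFamily o (code g) ↔ g ∈ MulAction.stabilizer (Perm (Fin n)) (setFamily n o) := by
  rw [MulAction.mem_stabilizer_finset']
  simp [preservesFamily, setFamily, mapsSet_code]

theorem alternatingGroup_le_of_closure_eq_top {α : Type*} [Fintype α] [DecidableEq α]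
    {s : Set (alternatingGroup α)} (hs : Subgroup.closure s = ⊤) {H : Subgroup (Perm α)}
    (h : ∀ g ∈ s, (g : Perm α) ∈ H) : alternatingGroup α ≤ H := by
  have : Subgroup.closure s ≤ H.comap (alternatingGroup α).subtype := (Subgroup.closure_le _).2 h
  rw [hs] at this
  exact fun g hg => this (Subgroup.mem_top (⟨g, hg⟩ : alternatingGroup α))

/-- A family of sets which is not preserved by all even permutations. -/
def IsProper (n : ℕ) (o : List ℕ) : Prop :=
  ¬ alternatingGroup (Fin n) ≤ MulAction.stabilizer (Perm (Fin n)) (setFamily n o)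

theorem IsProper.of_preservesFamily_eq_false [NeZero n] {o : List ℕ}
    (h : ∃ k : Fin n, sign (swap 0 1 * swap k (k + 1)) = 1 ∧
      preservesFamily o (code (swap 0 1 * swap k (k + 1))) = false) : IsProper n o := by
  obtain ⟨k, hs, hk⟩ := h
  intro hle
  rw [preservesFamily_code.2 (hle hs)] at hk
  cases hk

end SetFamilies

section Searches

/-- The partitions of a set of `n` elements into two non-empty parts. -/
def bipartitions (n : ℕ) : List (List ℕ) :=
  (List.range (2 ^ (n - 1) - 1)).map fun i => [2 * i + 1, 2 ^ n - 2 - 2 * i]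

/-- Families on six points: partitions into two parts, three partitions into three parts and two
designs with ten blocks of three points. -/
def familiesSix : List (List ℕ) :=
  bipartitions 6 ++ [[3, 12, 48], [5, 10, 48], [9, 6, 48],
    [7, 11, 21, 26, 28, 38, 41, 44, 49, 50], [7, 11, 22, 25, 28, 37, 42, 44, 49, 50]]

/-- Families on seven points: single sets, containing the first point, and six projective planes of
order two. -/
def familiesSeven : List (List ℕ) :=
  ((List.range 63).map fun i => [2 * i + 1]) ++
    [[19, 28, 37, 42, 70, 73, 112], [19, 28, 38, 41, 69, 74, 112],
      [21, 26, 35, 44, 70, 73, 112], [21, 26, 38, 41, 67, 76, 112],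
      [22, 25, 35, 44, 69, 74, 112], [22, 25, 37, 42, 67, 76, 112]]

set_option maxRecDepth 10000

theorem isProper_of_mem_familiesSix {o : List ℕ} (ho : o ∈ familiesSix) : IsProper 6 o :=
  .of_preservesFamily_eq_false <| by revert o; decide +kernel

theorem isProper_of_mem_familiesSeven {o : List ℕ} (ho : o ∈ familiesSeven) : IsProper 7 o :=
  .of_preservesFamily_eq_false <| by revert o; decide +kernel

theorem isProper_of_mem_bipartitions_eight {o : List ℕ} (ho : o ∈ bipartitions 8) : IsProper 8 o :=
  .of_preservesFamily_eq_false <| by revert o; decide +kernel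

/-- Whether for all even involutions `g₁` and `g₂`, the second one commuting with the permutation
with code `l₀`, a member of `O` is preserved by `g₁`, `g₂` and this permutation. -/
def checkTriples (n : ℕ) (O : List (List ℕ)) (l₀ : List ℕ) : Bool :=
  ((evenInvolutionCodes n).filter fun l₂ => codeMul l₀ l₂ == codeMul l₂ l₀).all fun l₂ =>
    (evenInvolutionCodes n).all fun l₁ => (O.filter (preservesFamily · l₀)).any fun o =>
      preservesFamily o l₁ && preservesFamily o l₂

theorem exists_mem_stabilizer_of_checkTriples {n : ℕ} {O : List (List ℕ)}
    {g₀ g₁ g₂ : Perm (Fin n)} (h : checkTriples n O (code g₀)) (h₁ : g₁ * g₁ = 1)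
    (h₂ : g₂ * g₂ = 1) (h₀₂ : g₀ * g₂ = g₂ * g₀) (hs₁ : sign g₁ = 1) (hs₂ : sign g₂ = 1) :
    ∃ o ∈ O, {g₀, g₁, g₂} ⊆ (MulAction.stabilizer (Perm (Fin n)) (setFamily n o) : Set _) := by
  have hcomm : codeMul (code g₀) (code g₂) == codeMul (code g₂) (code g₀) := by
    rw [codeMul_code, codeMul_code, h₀₂, beq_self_eq_true]
  have h' := List.all_eq_true.1 (List.all_eq_true.1 h _
    (List.mem_filter.2 ⟨code_mem_evenInvolutionCodes h₂ hs₂, hcomm⟩))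
    _ (code_mem_evenInvolutionCodes h₁ hs₁)
  simp only [List.any_eq_true, List.mem_filter, Bool.and_eq_true, preservesFamily_code] at h'
  obtain ⟨o, ⟨ho, ho₀⟩, ho₁, ho₂⟩ := h'
  exact ⟨o, ho, by simp [Set.insert_subset_iff, *]⟩

/-- Permutations of seven points which centralise `(0 1)(2 3)`. -/
def invertersSeven : List (Perm (Fin 7)) :=
  [1, swap 0 1 * swap 2 3, swap 0 2 * swap 1 3, swap 0 3 * swap 1 2].flatMap fun v =>
    [swap 4 5, swap 4 6, swap 5 6].map (v * ·)

theorem mul_swap_mul_swap_of_mem_invertersSeven :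
    ∀ d ∈ invertersSeven, d * (swap 0 1 * swap 2 3) = swap 0 1 * swap 2 3 * d :=
  List.all_iff_forall_prop.1 (by decide +kernel)

theorem checkTriples_six : checkTriples 6 familiesSix (code (n := 6) (swap 0 1 * swap 2 3)) := by
  rw [show code (n := 6) (swap 0 1 * swap 2 3) = [1, 0, 3, 2, 4, 5] by decide +kernel]
  decide +kernel

theorem checkTriples_seven :
    checkTriples 7 familiesSeven (code (n := 7) (swap 0 1 * swap 2 3)) := by
  rw [show code (n := 7) (swap 0 1 * swap 2 3) = [1, 0, 3, 2, 4, 5, 6] by decide +kernel]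
  decide +kernel

theorem checkTriples_eight :
    checkTriples 8 (bipartitions 8) (code (n := 8) (swap 0 1 * swap 2 3)) := by
  rw [show code (n := 8) (swap 0 1 * swap 2 3) = [1, 0, 3, 2, 4, 5, 6, 7] by decide +kernel]
  decide +kernel

theorem checkTriples_eight_of_support_eq_univ :
    checkTriples 8 (bipartitions 8)
      (code (n := 8) (swap 0 1 * swap 2 3 * swap 4 5 * swap 6 7)) := by
  rw [show code (n := 8) (swap 0 1 * swap 2 3 * swap 4 5 * swap 6 7) =
    [1, 0, 3, 2, 5, 4, 7, 6] by decide +kernel]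
  decide +kernel

theorem all_evenCodes_seven : (evenCodes 7).all fun l =>
    ((familiesSeven.filter (preservesFamily · (code (n := 7) (swap 0 1 * swap 2 3)))).any
      (preservesFamily · l)) ||
    (invertersSeven.map code).any fun d => codeMul l (codeMul d l) == d := by
  rw [show code (n := 7) (swap 0 1 * swap 2 3) = [1, 0, 3, 2, 4, 5, 6] by decide +kernel,
    show invertersSeven.map code =
      [[0, 1, 2, 3, 5, 4, 6], [0, 1, 2, 3, 6, 5, 4], [0, 1, 2, 3, 4, 6, 5],
        [1, 0, 3, 2, 5, 4, 6], [1, 0, 3, 2, 6, 5, 4], [1, 0, 3, 2, 4, 6, 5],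
        [2, 3, 0, 1, 5, 4, 6], [2, 3, 0, 1, 6, 5, 4], [2, 3, 0, 1, 4, 6, 5],
        [3, 2, 1, 0, 5, 4, 6], [3, 2, 1, 0, 6, 5, 4], [3, 2, 1, 0, 4, 6, 5]] by decide +kernel]
  decide +kernel

theorem exists_mem_stabilizer_or_inverted_seven {z : Perm (Fin 7)} (hz : sign z = 1) :
    (∃ o ∈ familiesSeven, {swap 0 1 * swap 2 3, z} ⊆
      (MulAction.stabilizer (Perm (Fin 7)) (setFamily 7 o) : Set _)) ∨
    ∃ d ∈ invertersSeven, z * (d * z) = d := by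
  have h := List.all_eq_true.1 all_evenCodes_seven _ (code_mem_evenCodes hz)
  rw [Bool.or_eq_true] at h
  refine h.imp (fun h => ?_) fun h => ?_
  · simp only [List.any_eq_true, List.mem_filter, preservesFamily_code] at h
    obtain ⟨o, ⟨ho, hs⟩, hz⟩ := h
    exact ⟨o, ho, by simp [Set.insert_subset_iff, *]⟩
  · simpa only [List.any_map, List.any_eq_true, Function.comp_apply, codeMul_code, beq_iff_eq,
      code_injective.eq_iff] using h

end Searches

section Involutions

variable {α : Type*} [Fintype α] [DecidableEq α] {g h : Perm α}

theorem cycleType_eq_replicate_of_mul_self_eq_one (hg : g * g = 1) :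
    g.cycleType = Multiset.replicate g.cycleType.card 2 :=
  have : Fact (Nat.Prime 2) := ⟨Nat.prime_two⟩
  cycleType_of_pow_prime_eq_one (by rw [sq, hg])

theorem two_mul_card_cycleType_of_mul_self_eq_one (hg : g * g = 1) :
    2 * g.cycleType.card = g.support.card := by
  rw [← sum_cycleType, cycleType_eq_replicate_of_mul_self_eq_one hg]
  simp [mul_comm]

theorem isConj_of_mul_self_eq_one (hg : g * g = 1) (hh : h * h = 1)
    (H : g.support.card = h.support.card) : IsConj g h := by
  have hcard : g.cycleType.card = h.cycleType.card := by
    have hg' := two_mul_card_cycleType_of_mul_self_eq_one hg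
    have hh' := two_mul_card_cycleType_of_mul_self_eq_one hh
    omega
  rw [isConj_iff_cycleType_eq, cycleType_eq_replicate_of_mul_self_eq_one hg,
    cycleType_eq_replicate_of_mul_self_eq_one hh, hcard]

theorem four_dvd_card_support_of_mul_self_eq_one (hg : g * g = 1) (hs : sign g = 1) :
    4 ∣ g.support.card := by
  have hsign := sign_of_cycleType g
  rw [hs, sum_cycleType, ← two_mul_card_cycleType_of_mul_self_eq_one hg, pow_add, pow_mul,
    neg_one_sq, one_pow, one_mul] at hsign
  have heven : Even g.cycleType.card := by
    by_contra hodd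
    rw [(Nat.not_even_iff_odd.1 hodd).neg_one_pow] at hsign
    exact absurd hsign (by decide)
  rw [← two_mul_card_cycleType_of_mul_self_eq_one hg]
  exact mul_dvd_mul_left 2 heven.two_dvd

theorem card_support_pos_of_ne_one (h : g ≠ 1) : 0 < g.support.card :=
  Nat.pos_of_ne_zero (mt card_support_eq_zero.1 h)

theorem isConj_swap_mul_swap (hg : g * g = 1) (h4 : g.support.card = 4) {a b c d : α}
    (hnodup : [a, b, c, d].Nodup) : IsConj g (swap a b * swap c d) := by
  have hdisj : Disjoint (swap a b) (swap c d) := disjoint_swap_swap hnodup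
  refine isConj_of_mul_self_eq_one hg ?_ (h4.trans ?_)
  · rw [hdisj.commute.symm.mul_mul_mul_comm, swap_mul_self, swap_mul_self, one_mul]
  · rw [hdisj.card_support_mul, card_support_swap (by aesop), card_support_swap (by aesop)]

theorem card_support_eq_four {n : ℕ} {g : Perm (Fin n)} (hn : n < 8)
    (hg : g * g = 1) (hs : sign g = 1) (h1 : g ≠ 1) : g.support.card = 4 := by
  have h₁ := four_dvd_card_support_of_mul_self_eq_one hg hs
  have h₂ := card_support_pos_of_ne_one h1
  have h₃ := (Finset.card_le_univ g.support).trans_eq (Fintype.card_fin n)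
  omega

end Involutions

section Exclusion

theorem exists_generators_ne_one_of_isRealised_one {G : Type} [Group G] [Nontrivial G]
    (h : IsRealised .one G) :
    ∃ a₀ a₁ a₂ : G, a₀ ≠ 1 ∧ a₀ * a₀ = 1 ∧ a₁ * a₁ = 1 ∧ a₂ * a₂ = 1 ∧ a₀ * a₂ = a₂ * a₀ ∧
      Subgroup.closure {a₀, a₁, a₂} = ⊤ := by
  obtain ⟨a₀, a₁, a₂, h₀, h₁, h₂, h₀₂, hgen⟩ := isRealised_one_iff.1 h
  by_cases e₀ : a₀ = 1
  · rw [e₀, Subgroup.closure_insert_one] at hgen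
    by_cases e₂ : a₂ = 1
    · rw [e₂, Set.pair_comm, Subgroup.closure_insert_one] at hgen
      refine ⟨a₁, a₁, a₁, ?_, h₁, h₁, h₁, rfl, by simpa using hgen⟩
      rintro rfl
      exact bot_ne_top (Subgroup.closure_singleton_one.symm.trans hgen)
    · exact ⟨a₂, a₁, a₂, e₂, h₂, h₁, h₂, rfl, by
        rwa [Set.insert_eq_of_mem (by simp)]⟩
  · exact ⟨a₀, a₁, a₂, e₀, h₀, h₁, h₂, h₀₂, hgen⟩

theorem not_isRealised_one_of_checkTriples {n : ℕ} (hn : 3 ≤ n) {O : List (List ℕ)}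
    (hO : ∀ o ∈ O, IsProper n o)
    (hcheck : ∀ g : Perm (Fin n), g * g = 1 → sign g = 1 → g ≠ 1 →
      ∃ h, IsConj g h ∧ checkTriples n O (code h)) :
    ¬ IsRealised .one (alternatingGroup (Fin n)) := by
  intro h
  have : Nontrivial (alternatingGroup (Fin n)) :=
    alternatingGroup.nontrivial_of_three_le_card (by rwa [Nat.card_fin])
  obtain ⟨a₀, a₁, a₂, hne, h₀, h₁, h₂, h₀₂, hgen⟩ := exists_generators_ne_one_of_isRealised_one h
  obtain ⟨g, hconj, hg⟩ := hcheck a₀ (congrArg Subtype.val h₀) a₀.2 (Subtype.coe_ne_coe.2 hne)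
  obtain ⟨c, rfl⟩ := isConj_iff.1 hconj
  let φ : alternatingGroup (Fin n) ≃* alternatingGroup (Fin n) := MulAut.conjNormal c
  have hφ {x : alternatingGroup (Fin n)} (hx : x * x = 1) : (φ x : Perm (Fin n)) * φ x = 1 := by
    rw [← Subgroup.coe_mul, ← map_mul, hx, map_one, Subgroup.coe_one]
  have hφ₀₂ : φ a₀ * φ a₂ = φ a₂ * φ a₀ := by rw [← map_mul, h₀₂, map_mul]
  obtain ⟨o, ho, hstab⟩ := exists_mem_stabilizer_of_checkTriples hg (hφ h₁) (hφ h₂)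
    (congrArg Subtype.val hφ₀₂) (φ a₁).2 (φ a₂).2
  refine hO o ho (alternatingGroup_le_of_closure_eq_top (closure_image_eq_top φ hgen) ?_)
  rintro _ ⟨x, (rfl | rfl | rfl), rfl⟩
  exacts [hstab (.inl rfl), hstab (.inr (.inl rfl)), hstab (.inr (.inr rfl))]

theorem not_isRealised_one_alternatingGroup_six :
    ¬ IsRealised .one (alternatingGroup (Fin 6)) :=
  not_isRealised_one_of_checkTriples (by norm_num) (fun _ => isProper_of_mem_familiesSix)
    fun _ hg hs h1 => ⟨_, isConj_swap_mul_swap hg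
      (card_support_eq_four (by norm_num) hg hs h1) (by decide), checkTriples_six⟩

theorem not_isRealised_one_alternatingGroup_seven :
    ¬ IsRealised .one (alternatingGroup (Fin 7)) :=
  not_isRealised_one_of_checkTriples (by norm_num) (fun _ => isProper_of_mem_familiesSeven)
    fun _ hg hs h1 => ⟨_, isConj_swap_mul_swap hg
      (card_support_eq_four (by norm_num) hg hs h1) (by decide), checkTriples_seven⟩

theorem not_isRealised_one_alternatingGroup_eight :
    ¬ IsRealised .one (alternatingGroup (Fin 8)) := by
  refine not_isRealised_one_of_checkTriples (by norm_num)
    (fun _ => isProper_of_mem_bipartitions_eight) fun g hg hs h1 => ?_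
  have hcard : g.support.card = 4 ∨ g.support.card = 8 := by
    have h₁ := four_dvd_card_support_of_mul_self_eq_one hg hs
    have h₂ := card_support_pos_of_ne_one h1
    have h₃ := (Finset.card_le_univ g.support).trans_eq (Fintype.card_fin 8)
    omega
  rcases hcard with h4 | h8
  · exact ⟨_, isConj_swap_mul_swap hg h4 (by decide), checkTriples_eight⟩
  · exact ⟨_, isConj_of_mul_self_eq_one hg (by decide +kernel) (h8.trans (by decide +kernel)),
      checkTriples_eight_of_support_eq_univ⟩

theorem isReflexible_alternatingGroup_seven {s z : alternatingGroup (Fin 7)} (hs : s * s = 1)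
    (hgen : Subgroup.closure {s, z} = ⊤) : IsReflexible s z := by
  by_cases h1 : s = 1
  · exact isReflexible_of_mul_comm hgen (by rw [h1, one_mul, mul_one])
  have hs' : (s : Perm (Fin 7)) * s = 1 := congrArg Subtype.val hs
  obtain ⟨c, hc⟩ := isConj_iff.1 (isConj_swap_mul_swap hs'
    (card_support_eq_four (by norm_num) hs' s.2 (Subtype.coe_ne_coe.2 h1))
    (a := 0) (b := 1) (c := 2) (d := 3) (by decide))
  let φ : alternatingGroup (Fin 7) ≃* alternatingGroup (Fin 7) := MulAut.conjNormal c
  refine .of_map φ ?_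
  have hφs : (φ s : Perm (Fin 7)) = swap 0 1 * swap 2 3 := hc
  rcases exists_mem_stabilizer_or_inverted_seven (φ z).2 with ⟨o, ho, hstab⟩ | ⟨d, hd, hdz⟩
  · refine absurd (alternatingGroup_le_of_closure_eq_top (closure_image_eq_top φ hgen) ?_)
      (isProper_of_mem_familiesSeven ho)
    rintro _ ⟨x, (rfl | rfl), rfl⟩
    exacts [hφs ▸ hstab (.inl rfl), hstab (.inr rfl)]
  · have hinv : (φ s)⁻¹ = φ s := by rw [← map_inv, inv_eq_of_mul_eq_one_left hs]
    refine ⟨MulAut.conjNormal d, Subtype.ext ?_, Subtype.ext ?_⟩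
    · rw [hinv, MulAut.conjNormal_apply, hφs, mul_swap_mul_swap_of_mem_invertersSeven d hd,
        mul_inv_cancel_right]
    · rw [MulAut.conjNormal_apply, Subgroup.coe_inv, mul_inv_eq_iff_eq_mul, eq_inv_mul_iff_mul_eq]
      exact hdz

end Exclusion

end SmallDegrees

theorem isRealised_alternatingGroup {n : ℕ} (hn : 5 ≤ n) {T : EdgeClass}
    (h : (T = .one ∧ (n = 5 ∨ 9 ≤ n)) ∨
      ((∃ σ, T = .two σ) ∨ T = .three ∨ (∃ σ, T = .four σ)) ∨
      ((∃ σ, T = .twoEx σ) ∧ 8 ≤ n) ∨ ((∃ σ, T = .five σ) ∧ 7 ≤ n)) :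
    IsRealised T (alternatingGroup (Fin n)) := by
  rcases h with ⟨rfl, h⟩ | (⟨σ, rfl⟩ | rfl | ⟨σ, rfl⟩) | ⟨⟨σ, rfl⟩, h⟩ | ⟨⟨σ, rfl⟩, h⟩
  · exact (isTripleGenerated_alternatingGroup h).isRealised_one
  · exact isRealised_two_iff_empty.2 (isInvolutionGenerated_alternatingGroup hn).isRealised_two
  · exact (isInvolutionGenerated_alternatingGroup hn).isRealised_three
  · exact isRealised_four_iff_empty.2 (isRealised_four_alternatingGroup hn)
  · exact isRealised_twoEx_iff_empty.2 (isChirallyGenerated_alternatingGroup h).isRealised_twoEx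
  · exact isRealised_five_iff_empty.2 (isRealised_five_alternatingGroup h)

theorem not_isRealised_one_alternatingGroup {n : ℕ} (hn : n = 6 ∨ n = 7 ∨ n = 8) :
    ¬ IsRealised .one (alternatingGroup (Fin n)) := by
  rcases hn with rfl | rfl | rfl
  exacts [not_isRealised_one_alternatingGroup_six, not_isRealised_one_alternatingGroup_seven,
    not_isRealised_one_alternatingGroup_eight]

theorem not_isRealised_twoEx_alternatingGroup {σ : Superscript} {n : ℕ}
    (hn : n = 5 ∨ n = 6 ∨ n = 7) :
    ¬ IsRealised (.twoEx σ) (alternatingGroup (Fin n)) := by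
  intro h
  obtain ⟨s, z, hs, hgen, hno⟩ := (isRealised_twoEx_iff_empty.1 h).exists_generators_twoEx
  rcases hn with rfl | rfl | rfl
  exacts [hno (isReflexible_alternatingGroup_five hgen),
    hno (isReflexible_alternatingGroup_six hgen), hno (isReflexible_alternatingGroup_seven hs hgen)]

theorem not_isRealised_five_alternatingGroup {σ : Superscript} {n : ℕ} (hn : n = 5 ∨ n = 6) :
    ¬ IsRealised (.five σ) (alternatingGroup (Fin n)) := by
  intro h
  obtain ⟨x, y, hgen, hno⟩ := (isRealised_five_iff_empty.1 h).exists_generators_five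
  rcases hn with rfl | rfl
  exacts [hno (isReflexible_alternatingGroup_five hgen),
    hno (isReflexible_alternatingGroup_six hgen)]

theorem edgeClass_of_isRealised_alternatingGroup {n : ℕ} (hn : 5 ≤ n) {T : EdgeClass}
    (h : IsRealised T (alternatingGroup (Fin n))) :
    (T = .one ∧ (n = 5 ∨ 9 ≤ n)) ∨
      ((∃ σ, T = .two σ) ∨ T = .three ∨ (∃ σ, T = .four σ)) ∨
      ((∃ σ, T = .twoEx σ) ∧ 8 ≤ n) ∨ ((∃ σ, T = .five σ) ∧ 7 ≤ n) := by
  cases T with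
  | two σ => exact .inr (.inl (.inl ⟨σ, rfl⟩))
  | three => exact .inr (.inl (.inr (.inl rfl)))
  | four σ => exact .inr (.inl (.inr (.inr ⟨σ, rfl⟩)))
  | one =>
    refine .inl ⟨rfl, ?_⟩
    by_contra hc
    exact not_isRealised_one_alternatingGroup (by omega) h
  | twoEx σ =>
    refine .inr (.inr (.inl ⟨⟨σ, rfl⟩, ?_⟩))
    by_contra hc
    exact not_isRealised_twoEx_alternatingGroup (by omega) h
  | five σ =>
    refine .inr (.inr (.inr ⟨⟨σ, rfl⟩, ?_⟩))
    by_contra hc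
    exact not_isRealised_five_alternatingGroup (by omega) h

end EdgeTransitive

theorem theorem4p2 (n : ℕ) (hn : 5 ≤ n) (T : EdgeTransitive.EdgeClass) :
    EdgeTransitive.IsRealised T (alternatingGroup (Fin n)) ↔
      (T = .one ∧ (n = 5 ∨ 9 ≤ n)) ∨
      ((∃ σ, T = .two σ) ∨ T = .three ∨ (∃ σ, T = .four σ)) ∨
      ((∃ σ, T = .twoEx σ) ∧ 8 ≤ n) ∨
      ((∃ σ, T = .five σ) ∧ 7 ≤ n) :=
  ⟨EdgeTransitive.edgeClass_of_isRealised_alternatingGroup hn,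
    EdgeTransitive.isRealised_alternatingGroup hn⟩
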